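/- **Setting.** Let $P_C$ be a probability distribution on a set $\mathcal C$ of concepts; each concept $c\in\mathcal C$ is a probability distribution on a sample space $\mathcal Z$. Given a concept $C\sim P_C$, a dataset $S\in\mathcal Z^m$ consists of $m$ i.i.d. samples of $C$; write $P_S$ for the marginal law of $S$. Let $\mathcal H$ be a set of models (a standard Borel space), $\ell_c(h,z)\in[0,1]$ a measurable loss, and $s\mapsto Q_{H|S=s}$ the transmitter's learning rule, which maps a dataset to a probability distribution on $\mathcal H$. For a distribution $q$ on $\mathcal H$ put $\mathcal L_c(q)=\mathbb E_{Z\sim c}\,\mathbb E_{h\sim q}\,\ell_c(h,Z)$, and for conditional distributions $Q_{H|S},\hat Q_{H|S}$ put $$d_{sem}(Q,\hat Q)=\mathbb E_{C,S}\big[\mathcal L_C(\hat Q_{H|S})-\mathcal L_C(Q_{H|S})\big].$$ **Codes.** Let $P_H$ be an arbitrary probability distribution on $\mathcal H$ (the pre-data coding distribution). A code for $n$ concepts with pre-data coding distribution $P_H$ and common randomness consists of a random variable $\omega$ of arbitrary law, shared by both parties and independent of the i.i.d. datasets $S_1,\dots,S_n\sim P_S$, which determines an i.i.d. sequence of candidates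 $X_0(\omega),X_1(\omega),\dots\sim P_H^{\otimes n}$ (and may contain further randomness), and an encoder $f$ that selects an index $K=f(S^n,\omega)\in\mathbb N$. The index is sent, and the decoder outputs $\hat H^n=X_K(\omega)\in\mathcal H^n$. The code has *fixed rate* $R$ if $K$ takes at most $2^{nR}$ values $0,\dots,M-1$ ($M\le 2^{nR}$), and *average rate* $R$ if, for some prefix-free binary code for the natural numbers, the expected length of the codeword of $K$ is at most $nR$ bits. Let $\hat Q_i$ be the conditional law of $\hat H_i$ given $S_i$, and $$d_{avg}=\frac1n\sum_{i=1}^n d_{sem}(Q,\hat Q_i),\qquad d_{max}=\max_{1\le i\le n}d_{sem}(Q,\hat Q_i).$$ For either notion of rate and for $d\in\{d_{avg},d_{max}\}$, a pair $(R,\epsilon)$ is achievable if there is a sequence of codes, one for each $n$, whose rate is $R$ for all sufficiently large $n$ and whose distortions $d$ converge, as $n\to\infty$, to a limit less than $\epsilon$. The rate-distortion region is the closure of the set of achievable pairs, and $R(\epsilon)$ is the infimum of the rates $R$ such that $(R,\epsilon)$ lies in the region ($\infty$ if there is none). **Theorem 2 (Achievability with general $P_H$).** For every $\epsilon\in\mathbb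 R$, for both $d_{avg}$ and $d_{max}$, and for both fixed and average rate, $$R(\epsilon)=\min_{\tilde Q_{H|S}\,:\;d_{sem}(Q,\tilde Q)\le\epsilon}\ \mathbb E_{C,S}\Big[D_{\mathrm{KL}}\big(\tilde Q_{H|S}\,\big\|\,P_H\big)\Big],$$ where $D_{\mathrm{KL}}$ is measured in bits. The minimum is attained whenever some $\tilde Q_{H|S}$ satisfies the constraint (in particular if $\epsilon\ge0$); otherwise both sides are $\infty$. -/

import Mathlib

open MeasureTheory ProbabilityTheory Filter Topology InformationTheory
open scoped ENNReal NNReal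

namespace ConceptComm

universe u v w

/-- The law of `m` i.i.d. samples of a distribution depends measurably on the distribution. -/
theorem measurable_pi_kernel {C : Type u} {Z : Type v} [MeasurableSpace C] [MeasurableSpace Z]
    (κ : Kernel C Z) [IsMarkovKernel κ] (m : ℕ) :
    Measurable fun c : C => Measure.pi fun _ : Fin m => κ c := by
  refine Measurable.measure_of_isPiSystem_of_isProbabilityMeasure generateFrom_pi.symm
    isPiSystem_pi ?_
  rintro _ ⟨s, hs, rfl⟩
  simp only [Measure.pi_pi]
  refine Finset.measurable_prod _ fun i _ => ?_
  exact κ.measurable_coe (hs i (Set.mem_univ i))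

/-- The data of the problem of communicating concepts.  `C` is the set of concepts, `Z` the set
of samples, `H` the set of models. -/
structure Problem (C : Type u) (Z : Type v) (H : Type w)
    [MeasurableSpace C] [MeasurableSpace Z] [MeasurableSpace H] where
  /-- the law `P_C` of a concept -/
  conceptLaw : Measure C
  isProb_conceptLaw : IsProbabilityMeasure conceptLaw
  /-- the distribution on samples that a concept stands for -/
  sample : Kernel C Z
  isMarkov_sample : IsMarkovKernel sample
  /-- the number of samples in a dataset -/
  m : ℕ
  /-- the loss `ℓ_c(h, z)` -/
  loss : C → H → Z → ℝ
  measurable_loss : Measurable fun x : C × H × Z => loss x.1 x.2.1 x.2.2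
  loss_mem : ∀ c h z, loss c h z ∈ Set.Icc (0 : ℝ) 1
  /-- the transmitter's learning rule, `s ↦ Q_{H|S=s}` -/
  belief : Kernel (Fin m → Z) H
  isMarkov_belief : IsMarkovKernel belief

attribute [instance] Problem.isProb_conceptLaw Problem.isMarkov_sample Problem.isMarkov_belief

noncomputable section

namespace Problem

variable {C : Type u} {Z : Type v} {H : Type w}
  [MeasurableSpace C] [MeasurableSpace Z] [MeasurableSpace H]

/-- A dataset: `m` samples. -/
abbrev Dataset (𝓒 : Problem C Z H) : Type v := Fin 𝓒.m → Z

/-- `P_{S|C}`: given the concept `c`, the samples in the dataset are i.i.d. from `c`. -/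
def dataset (𝓒 : Problem C Z H) : Kernel C 𝓒.Dataset where
  toFun c := Measure.pi fun _ => 𝓒.sample c
  measurable' := measurable_pi_kernel 𝓒.sample 𝓒.m

instance (𝓒 : Problem C Z H) : IsMarkovKernel 𝓒.dataset :=
  ⟨fun c => inferInstanceAs (IsProbabilityMeasure (Measure.pi fun _ => 𝓒.sample c))⟩

/-- The joint law of `(C, S)`. -/
def jointLaw (𝓒 : Problem C Z H) : Measure (C × 𝓒.Dataset) := 𝓒.conceptLaw ⊗ₘ 𝓒.dataset

instance (𝓒 : Problem C Z H) : IsProbabilityMeasure 𝓒.jointLaw :=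
  inferInstanceAs (IsProbabilityMeasure (𝓒.conceptLaw ⊗ₘ 𝓒.dataset))

/-- The marginal law `P_S` of a dataset. -/
def dataLaw (𝓒 : Problem C Z H) : Measure 𝓒.Dataset := 𝓒.jointLaw.snd

instance (𝓒 : Problem C Z H) : IsProbabilityMeasure 𝓒.dataLaw :=
  inferInstanceAs (IsProbabilityMeasure 𝓒.jointLaw.snd)

/-- The true loss `L_c(q) = E_{z ∼ c} E_{h ∼ q} ℓ_c(h, z)` of a belief `q` on the models. -/
def trueLoss (𝓒 : Problem C Z H) (c : C) (q : Measure H) : ℝ :=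
  ∫ z, ∫ h, 𝓒.loss c h z ∂q ∂(𝓒.sample c)

/-- The concept distortion `d_sem(Q, Q̂) = E_{C,S}[L_C(Q̂_{H|S}) - L_C(Q_{H|S})]`. -/
def dSem (𝓒 : Problem C Z H) (Q Qhat : Kernel 𝓒.Dataset H) : ℝ :=
  ∫ x, (𝓒.trueLoss x.1 (Qhat x.2) - 𝓒.trueLoss x.1 (Q x.2)) ∂𝓒.jointLaw

/-- Kullback-Leibler divergence in bits. -/
def klBits (μ ν : Measure H) : ℝ≥0∞ := klDiv μ ν / ENNReal.ofReal (Real.log 2)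

/-- `E_{C,S}[D_KL(Q̃_{H|S} ‖ P_H)]`, in bits. -/
def klCost (𝓒 : Problem C Z H) (P : Measure H) (Qtilde : Kernel 𝓒.Dataset H) : ℝ≥0∞ :=
  ∫⁻ x, klBits (Qtilde x.2) P ∂𝓒.jointLaw

/-- The conditional distributions `Q̃_{H|S}` with `d_sem(Q, Q̃) ≤ ε`. -/
def feasible (𝓒 : Problem C Z H) (ε : ℝ) : Set (Kernel 𝓒.Dataset H) :=
  {Qtilde | IsMarkovKernel Qtilde ∧ 𝓒.dSem 𝓒.belief Qtilde ≤ ε}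

/-- A code for `n` concepts with common randomness `ω ∼ p` and pre-data coding distribution `P`:
`ω` provides both parties with an i.i.d. sequence of candidates `X₀(ω), X₁(ω), … ∼ P^{⊗n}`
(and possibly with further randomness); the encoder, seeing `(sⁿ, ω)`, selects an index `k`,
which is the message, and the decoder outputs the candidate `X_k(ω)`. -/
structure Code (𝓒 : Problem C Z H) (P : Measure H) (n : ℕ) where
  Ω : Type w
  [mΩ : MeasurableSpace Ω]
  p : Measure Ω
  isProb : IsProbabilityMeasure p
  cand : ℕ → Ω → (Fin n → H)
  measurable_cand : ∀ k, Measurable (cand k)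
  map_cand : ∀ k, p.map (cand k) = Measure.pi fun _ => P
  indep_cand : iIndepFun cand p
  enc : (Fin n → 𝓒.Dataset) × Ω → ℕ
  measurable_enc : Measurable enc

attribute [instance] Code.mΩ Code.isProb

namespace Code

variable {𝓒 : Problem C Z H} {P : Measure H} {n : ℕ}

/-- The decoder's output, as a function of the message and the common randomness. -/
def dec (c : Code 𝓒 P n) (k : ℕ) (ω : c.Ω) : Fin n → H := c.cand k ω

/-- The law of `(Sⁿ, ω)`: the datasets are i.i.d., and independent of the common randomness. -/
def inputLaw (c : Code 𝓒 P n) : Measure ((Fin n → 𝓒.Dataset) × c.Ω) :=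
  (Measure.pi fun _ => 𝓒.dataLaw).prod c.p

instance (c : Code 𝓒 P n) : IsProbabilityMeasure c.inputLaw :=
  inferInstanceAs (IsProbabilityMeasure ((Measure.pi fun _ => 𝓒.dataLaw).prod c.p))

/-- The law of `(S_i, Ĥ_i)` induced by the code, where `Ĥⁿ` is the decoder's output. -/
def outJoint (c : Code 𝓒 P n) (i : Fin n) : Measure (𝓒.Dataset × H) :=
  c.inputLaw.map fun x => (x.1 i, c.dec (c.enc x) x.2 i)

instance (c : Code 𝓒 P n) (i : Fin n) : IsFiniteMeasure (c.outJoint i) :=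
  inferInstanceAs (IsFiniteMeasure (c.inputLaw.map _))

/-- The receiver's belief about the `i`-th model: the conditional law of `Ĥ_i` given `S_i`. -/
def outBelief [StandardBorelSpace H] [Nonempty H] (c : Code 𝓒 P n) (i : Fin n) :
    Kernel 𝓒.Dataset H := (c.outJoint i).condKernel

/-- `d_avg(Qⁿ, Q̂ⁿ)` -/
def dAvg [StandardBorelSpace H] [Nonempty H] (c : Code 𝓒 P n) : ℝ :=
  (1 / (n : ℝ)) * ∑ i, 𝓒.dSem 𝓒.belief (c.outBelief i)

/-- `d_max(Qⁿ, Q̂ⁿ)` -/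
def dMax [StandardBorelSpace H] [Nonempty H] (c : Code 𝓒 P n) : ℝ :=
  ⨆ i, 𝓒.dSem 𝓒.belief (c.outBelief i)

/-- Fixed-length coding at rate `R`: at most `2^{nR}` messages are used. -/
def HasFixedRate (c : Code 𝓒 P n) (R : ℝ≥0) : Prop :=
  ∃ M : ℕ, (M : ℝ) ≤ 2 ^ ((n : ℝ) * (R : ℝ)) ∧ ∀ x, c.enc x < M

/-- Variable-length coding at rate `R`: with some prefix-free binary code for the messages,
the expected number of bits is at most `nR`. -/
def HasAverageRate (c : Code 𝓒 P n) (R : ℝ≥0) : Prop :=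
  ∃ word : ℕ → List Bool, (∀ j k, j ≠ k → ¬ word j <+: word k) ∧
    ∫⁻ x, ((word (c.enc x)).length : ℝ≥0∞) ∂c.inputLaw ≤ (n : ℝ≥0∞) * (R : ℝ≥0∞)

end Code

/-- How the rate of a code is measured. -/
inductive RateKind
  | fixed
  | average

/-- How the distortion of a sequence is measured. -/
inductive DistortionKind
  | avg
  | max

/-- The code has rate at most `R`. -/
def Code.HasRate {𝓒 : Problem C Z H} {P : Measure H} {n : ℕ} (c : Code 𝓒 P n) (R : ℝ≥0) :
    RateKind → Prop
  | .fixed => c.HasFixedRate R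
  | .average => c.HasAverageRate R

/-- The distortion of the code. -/
def Code.distortion [StandardBorelSpace H] [Nonempty H] {𝓒 : Problem C Z H} {P : Measure H}
    {n : ℕ} (c : Code 𝓒 P n) : DistortionKind → ℝ
  | .avg => c.dAvg
  | .max => c.dMax

/-- `(R, ε)` is achievable with pre-data coding distribution `P`: some sequence of codes of rate
at most `R` (for all large block lengths `n`) has a limiting distortion less than `ε`. -/
def Achievable [StandardBorelSpace H] [Nonempty H] (𝓒 : Problem C Z H) (P : Measure H)
    (r : RateKind) (d : DistortionKind) (R : ℝ≥0) (ε : ℝ) : Prop :=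
  ∃ code : ∀ n : ℕ, Code 𝓒 P n,
    (∀ᶠ n in atTop, (code n).HasRate R r) ∧
    ∃ L : ℝ, L < ε ∧ Tendsto (fun n => (code n).distortion d) atTop (𝓝 L)

/-- The rate-distortion region: the closure of the set of achievable pairs. -/
def region [StandardBorelSpace H] [Nonempty H] (𝓒 : Problem C Z H) (P : Measure H)
    (r : RateKind) (d : DistortionKind) : Set (ℝ≥0 × ℝ) :=
  closure {x | 𝓒.Achievable P r d x.1 x.2}

/-- The rate-distortion function: the infimum of the `R` with `(R, ε)` in the region (`∞` if
there is none). -/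
def rateDistortion [StandardBorelSpace H] [Nonempty H] (𝓒 : Problem C Z H) (P : Measure H)
    (r : RateKind) (d : DistortionKind) (ε : ℝ) : ℝ≥0∞ :=
  ⨅ (R : ℝ≥0) (_ : (R, ε) ∈ 𝓒.region P r d), (R : ℝ≥0∞)

end Problem

end

end ConceptComm

/-!
# The rate-distortion function of concept communication with a general pre-data distribution

Write `σ` for the law of a dataset, `ν = σ × P`, and read a kernel `Q` as the joint law `σ ⊗ₘ Q` of
(dataset, model). Two facts make everything a question about such joint laws. The chain rule
`lintegral_klDiv_eq` turns the cost of `Q` into the divergence of `σ ⊗ₘ Q` from `ν`, and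
`exists_isPosteriorLoss` gives a function `ρ` on (dataset, model), the conditional expectation of the
loss, with which the distortion of `Q` is the integral of `ρ` against `σ ⊗ₘ Q` up to a constant.

*Converse.* The bound "divergence at most `R`" is used in its Donsker-Varadhan form `GibbsBound`,
which is linear in the joint law. For a code it follows from one application of Jensen's inequality
and a union bound over the candidates, weighted by Kraft's inequality
(`Code.gibbsBound_avgJoint`). It passes at once to the average of the output laws over the positions,
and to limits. A Gibbs bound implies uniform absolute continuity with respect to `ν`, so the average
output laws of a sequence of codes have a limit on all measurable sets along an ultrafilter
(`exists_tendsto_measure_of_unif_absolutelyContinuous`); no topology on the datasets is needed. The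
limit disintegrates into a kernel, which is feasible and has divergence at most `R`
(`GibbsBound.klDiv_le`, `exists_feasible_of_mem_region`). As the region is closed, this also shows
that the minimum is attained.

*Achievability.* With `exp (n * c)` candidates, where `c` exceeds the divergence of `σ ⊗ₘ Q` from
`ν`, with high probability some candidate is jointly typical with the datasets
(`measure_forall_notMem_le`, `tendsto_one_sub_typicalSet`). The encoder selects the candidate whose
mean loss is *nearest* to the mean loss of `Q`, and not the one of least loss: so the distortions
converge, as achievability demands. The selection is invariant under permutations of the positions,
hence all positions have the same distortion and the average equals the maximum
(`exists_code_tendsto`).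
-/

namespace ConceptComm

/-! ### Prefix-free codes of the natural numbers -/

theorem uniquelyDecodable_of_prefixFree {S : Set (List Bool)} (hnil : [] ∉ S)
    (h : ∀ v ∈ S, ∀ w ∈ S, v <+: w → v = w) : UniquelyDecodable S := by
  intro L₁
  induction L₁ with
  | nil =>
    intro L₂ _ h₂ he
    cases L₂ with
    | nil => rfl
    | cons w L =>
      exfalso
      have : w = [] := by
        have := he.symm
        simp only [List.flatten_nil, List.flatten_cons, List.append_eq_nil_iff] at this
        exact this.1
      exact hnil (this ▸ h₂ w (by simp))
  | cons v L₁ ih =>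
    intro L₂ h₁ h₂ he
    cases L₂ with
    | nil =>
      exfalso
      have : v = [] := by
        simp only [List.flatten_nil, List.flatten_cons, List.append_eq_nil_iff] at he
        exact he.1
      exact hnil (this ▸ h₁ v (by simp))
    | cons w L₂ =>
      simp only [List.flatten_cons] at he
      have hv := h₁ v (by simp)
      have hw := h₂ w (by simp)
      have hvw : v = w := by
        have h1 : v <+: v ++ L₁.flatten := List.prefix_append _ _
        have h2 : w <+: v ++ L₁.flatten := he ▸ List.prefix_append _ _
        rcases List.prefix_or_prefix_of_prefix h1 h2 with hp | hp
        · exact h v hv w hw hp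
        · exact (h w hw v hv hp).symm
      subst hvw
      rw [ih L₂ (fun x hx => h₁ x (by simp [hx])) (fun x hx => h₂ x (by simp [hx]))
        (List.append_cancel_left he)]

/-- **Kraft's inequality** for a prefix-free binary code of the natural numbers. -/
theorem tsum_two_inv_pow_length_le_one {word : ℕ → List Bool}
    (h : ∀ j k, j ≠ k → ¬ word j <+: word k) :
    ∑' k, (2⁻¹ : ℝ≥0∞) ^ (word k).length ≤ 1 := by
  have hinj : Function.Injective word := fun j k hjk => by
    by_contra hne
    exact h j k hne (hjk ▸ List.prefix_refl _)
  rw [ENNReal.tsum_eq_iSup_sum]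
  refine iSup_le fun F => ?_
  have hUD : UniquelyDecodable ((F.image word : Finset (List Bool)) : Set (List Bool)) := by
    refine uniquelyDecodable_of_prefixFree ?_ ?_
    · intro hmem
      simp only [Finset.coe_image, Set.mem_image] at hmem
      obtain ⟨k, _, hk⟩ := hmem
      exact h k (k + 1) (by simp) (hk ▸ List.nil_prefix)
    · intro v hv w hw hvw
      simp only [Finset.coe_image, Set.mem_image] at hv hw
      obtain ⟨j, _, rfl⟩ := hv
      obtain ⟨k, _, rfl⟩ := hw
      by_contra hne
      exact h j k (fun hjk => hne (hjk ▸ rfl)) hvw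
  have hK := kraft_mcmillan_inequality hUD
  rw [Finset.sum_image hinj.injOn] at hK
  have e : ∀ m : ℕ, (2⁻¹ : ℝ≥0∞) ^ m = ENNReal.ofReal ((1 / Fintype.card Bool : ℝ) ^ m) := by
    intro m
    rw [ENNReal.ofReal_pow (by positivity)]
    congr 1
    rw [Fintype.card_bool, one_div, Nat.cast_ofNat, ENNReal.ofReal_inv_of_pos (by norm_num)]
    simp
  simp_rw [e]
  rw [← ENNReal.ofReal_sum_of_nonneg (fun _ _ => by positivity)]
  exact ENNReal.ofReal_le_one.2 hK

/-- A prefix-free code of the natural numbers that spends one bit more than the fixed-length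
binary representation on the numbers below `2 ^ b`. The leading bit marks the other numbers, which
are written in unary. -/
theorem exists_prefixFree_length_eq (b : ℕ) :
    ∃ word : ℕ → List Bool, (∀ j k, j ≠ k → ¬ word j <+: word k) ∧
      ∀ k < 2 ^ b, (word k).length = b + 1 := by
  refine ⟨fun k => if k < 2 ^ b then false :: List.ofFn (fun i : Fin b => k.testBit i)
    else true :: (List.replicate k true ++ [false]), ?_, ?_⟩
  · intro j k hjk hpre
    dsimp only at hpre
    split_ifs at hpre with hj hk hk
    · have := (List.cons_prefix_cons.1 hpre).2
      have := this.eq_of_length (by simp)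
      have hf := List.ofFn_injective this
      refine hjk (Nat.eq_of_testBit_eq fun i => ?_)
      by_cases hi : i < b
      · exact congrFun hf ⟨i, hi⟩
      · push Not at hi
        rw [Nat.testBit_lt_two_pow (hj.trans_le (Nat.pow_le_pow_right (by norm_num) hi)),
          Nat.testBit_lt_two_pow (hk.trans_le (Nat.pow_le_pow_right (by norm_num) hi))]
    · simp [List.cons_prefix_cons] at hpre
    · simp [List.cons_prefix_cons] at hpre
    · have hp := (List.cons_prefix_cons.1 hpre).2
      have hlen := hp.length_le
      simp only [List.length_append, List.length_replicate, List.length_cons,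
        List.length_nil, add_le_add_iff_right] at hlen
      have hlt : j < k := lt_of_le_of_ne hlen hjk
      have h1 := hp.getElem (i := j) (by simp)
      rw [List.getElem_append_right (by simp), List.getElem_append_left (by simpa using hlt)] at h1
      simp at h1
  · intro k hk
    simp [hk]

/-! ### Setwise limits of probability measures -/

/-- Convergence along a filter on all measurable sets implies convergence of the integrals of all
bounded measurable functions. -/
theorem tendsto_integral_of_tendsto_measure {X ι : Type*} [MeasurableSpace X] {l : Filter ι}
    {μs : ι → Measure X} {μ : Measure X} [∀ k, IsProbabilityMeasure (μs k)]
    [IsProbabilityMeasure μ]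
    (h : ∀ A, MeasurableSet A → Tendsto (fun k => μs k A) l (𝓝 (μ A)))
    {g : X → ℝ} (hg : Measurable g) {K : ℝ} (hK : ∀ x, |g x| ≤ K) :
    Tendsto (fun k => ∫ x, g x ∂(μs k)) l (𝓝 (∫ x, g x ∂μ)) := by
  -- uniform approximation of `g` by the simple functions `δ * ⌊g / δ⌋`
  have happrox : ∀ δ > 0, ∃ f : SimpleFunc X ℝ, ∀ x, |g x - f x| ≤ δ := by
    intro δ hδ
    let u : X → ℝ := fun x => δ * (⌊g x / δ⌋ : ℝ)
    have hu : Measurable u := by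
      have h1 : Measurable fun x => ⌊g x / δ⌋ := Int.measurable_floor.comp (hg.div_const δ)
      exact ((measurable_from_top (f := fun n : ℤ => (n : ℝ))).comp h1).const_mul δ
    have hfin : (Set.range u).Finite := by
      refine Set.Finite.subset
        ((Set.finite_Icc ⌊-K / δ⌋ ⌊K / δ⌋).image fun n : ℤ => δ * (n : ℝ)) ?_
      rintro _ ⟨x, rfl⟩
      refine ⟨⌊g x / δ⌋, ⟨Int.floor_mono ?_, Int.floor_mono ?_⟩, rfl⟩
      · have := neg_le_of_abs_le (hK x); gcongr
      · have := le_of_abs_le (hK x); gcongr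
    refine ⟨⟨u, fun y => hu (measurableSet_singleton y), hfin⟩, fun x => ?_⟩
    change |g x - δ * (⌊g x / δ⌋ : ℝ)| ≤ δ
    have h1 := Int.floor_le (g x / δ)
    have h2 := Int.lt_floor_add_one (g x / δ)
    rw [le_div_iff₀ hδ] at h1
    rw [div_lt_iff₀ hδ] at h2
    rw [abs_le]
    constructor <;> nlinarith
  have hsimple : ∀ f : SimpleFunc X ℝ,
      Tendsto (fun k => ∫ x, f x ∂(μs k)) l (𝓝 (∫ x, f x ∂μ)) := by
    intro f
    have e : ∀ m : Measure X, IsProbabilityMeasure m →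
        ∫ x, f x ∂m = ∑ y ∈ f.range, m.real (f ⁻¹' {y}) • y := fun m _ => by
      rw [← SimpleFunc.integral_eq_integral f (SimpleFunc.integrable_of_isFiniteMeasure f),
        SimpleFunc.integral_eq]
    rw [e μ inferInstance]
    simp_rw [fun k => e (μs k) inferInstance]
    refine tendsto_finsetSum _ fun y _ => Tendsto.smul_const ?_ y
    exact (ENNReal.tendsto_toReal (measure_ne_top _ _)).comp (h _ (f.measurableSet_fiber y))
  have hint : ∀ m : Measure X, IsProbabilityMeasure m → Integrable g m := fun m _ =>
    Integrable.of_bound hg.aestronglyMeasurable K (ae_of_all _ hK)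
  have hclose : ∀ m : Measure X, IsProbabilityMeasure m → ∀ (f : SimpleFunc X ℝ) (δ : ℝ),
      (∀ x, |g x - f x| ≤ δ) → |∫ x, g x ∂m - ∫ x, f x ∂m| ≤ δ := by
    intro m _ f δ hf
    rw [← integral_sub (hint m inferInstance) (SimpleFunc.integrable_of_isFiniteMeasure f)]
    have := norm_integral_le_of_norm_le_const (μ := m) (f := fun x => g x - f x) (C := δ)
      (ae_of_all _ hf)
    simpa using this
  rw [Metric.tendsto_nhds]
  intro e he
  obtain ⟨f, hf⟩ := happrox (e / 4) (by positivity)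
  filter_upwards [Metric.tendsto_nhds.1 (hsimple f) (e / 4) (by positivity)] with k hk
  rw [Real.dist_eq] at hk ⊢
  have h1 := hclose (μs k) inferInstance f _ hf
  have h2 := hclose μ inferInstance f _ hf
  rw [abs_le] at h1 h2
  rw [abs_lt] at hk ⊢
  constructor <;> linarith

/-- A sequence of probability measures that is uniformly absolutely continuous with respect to a
finite measure has a limit on all measurable sets, along any ultrafilter. No topology on the space
is involved: the pointwise limit of the set functions is finitely additive, and uniform absolute
continuity makes it countably additive. -/
theorem exists_tendsto_measure_of_unif_absolutelyContinuous {X ι : Type*} [MeasurableSpace X]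
    (l : Ultrafilter ι) (μs : ι → Measure X) [∀ k, IsProbabilityMeasure (μs k)]
    (ν : Measure X) [IsFiniteMeasure ν]
    (h : ∀ e : ℝ≥0∞, 0 < e → ∃ δ : ℝ≥0∞, 0 < δ ∧ ∀ A, MeasurableSet A → ν A ≤ δ →
      ∀ᶠ k in l, μs k A ≤ e) :
    ∃ μ : Measure X, IsProbabilityMeasure μ ∧
      ∀ A, MeasurableSet A → Tendsto (fun k => μs k A) l (𝓝 (μ A)) := by
  have hlim : ∀ A : Set X, ∃ a : ℝ≥0∞, Tendsto (fun k => μs k A) l (𝓝 a) := fun A => by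
    obtain ⟨a, _, ha⟩ := isCompact_univ.ultrafilter_le_nhds (l.map fun k => μs k A) (by simp)
    exact ⟨a, ha⟩
  choose m hm using hlim
  have hle1 : ∀ A, m A ≤ 1 := fun A => le_of_tendsto (hm A) (Eventually.of_forall fun _ => prob_le_one)
  have hempty : m ∅ = 0 := tendsto_nhds_unique (hm ∅) (by simp)
  have huniv : m Set.univ = 1 := tendsto_nhds_unique (hm Set.univ) (by simp)
  have hunion : ∀ A B, MeasurableSet B → Disjoint A B → m (A ∪ B) = m A + m B := by
    intro A B hB hAB
    refine tendsto_nhds_unique (hm (A ∪ B)) ?_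
    simp_rw [fun k => measure_union (μ := μs k) hAB hB]
    exact (hm A).add (hm B)
  have hring : IsSetRing {A : Set X | MeasurableSet A} :=
    { empty_mem := MeasurableSet.empty
      union_mem := fun _ _ hs ht => hs.union ht
      sdiff_mem := fun _ _ hs ht => hs.diff ht }
  let c : AddContent ℝ≥0∞ {A : Set X | MeasurableSet A} :=
    hring.addContent_of_union m hempty fun _ ht hst => hunion _ _ ht hst
  have hσ : ∀ ⦃f : ℕ → Set X⦄, (∀ i, MeasurableSet (f i)) → Pairwise (Function.onFun Disjoint f) →
      m (⋃ i, f i) = ∑' i, m (f i) := by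
    intro f hf hd
    refine addContent_iUnion_eq_sum_of_tendsto_zero hring c
      (fun s _ => ne_top_of_le_ne_top ENNReal.one_ne_top (hle1 s)) ?_ hf (MeasurableSet.iUnion hf) hd
    intro s hs hanti hinter
    rw [ENNReal.tendsto_nhds_zero]
    intro e he
    obtain ⟨δ, hδ, hδ'⟩ := h e he
    have hν : Tendsto (fun n => ν (s n)) atTop (𝓝 0) := by
      have := tendsto_measure_iInter_atTop (μ := ν) (fun n => (hs n).nullMeasurableSet) hanti
        ⟨0, measure_ne_top _ _⟩
      rwa [hinter, measure_empty] at this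
    filter_upwards [ENNReal.tendsto_nhds_zero.1 hν δ hδ] with n hn
    exact le_of_tendsto (hm (s n)) (hδ' _ (hs n) hn)
  refine ⟨Measure.ofMeasurable (fun A _ => m A) hempty fun f hf hd => hσ hf hd, ⟨?_⟩, ?_⟩
  · rw [Measure.ofMeasurable_apply _ MeasurableSet.univ, huniv]
  · intro A hA
    rw [Measure.ofMeasurable_apply _ hA]
    exact hm A

/-! ### The variational form of a divergence bound -/

/-- The Donsker-Varadhan inequalities `∫ g ∂μ ≤ R + log ∫ exp g ∂ν` for all bounded measurable `g`.
For probability measures they say that the Kullback-Leibler divergence of `μ` from `ν` is at most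
`R` nats, in a form that is linear in `μ`. -/
def GibbsBound {X : Type*} [MeasurableSpace X] (R : ℝ) (μ ν : Measure X) : Prop :=
  ∀ g : X → ℝ, Measurable g → (∃ K, ∀ x, |g x| ≤ K) →
    ∫ x, g x ∂μ ≤ R + Real.log (∫ x, Real.exp (g x) ∂ν)

theorem integrable_of_bounded {X : Type*} [MeasurableSpace X] {μ : Measure X} [IsFiniteMeasure μ]
    {g : X → ℝ} (hg : Measurable g) {K : ℝ} (hK : ∀ x, |g x| ≤ K) : Integrable g μ :=
  Integrable.of_bound hg.aestronglyMeasurable K (ae_of_all _ hK)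

theorem integrable_exp_of_bounded {X : Type*} [MeasurableSpace X] {μ : Measure X}
    [IsFiniteMeasure μ] {g : X → ℝ} (hg : Measurable g) {K : ℝ} (hK : ∀ x, |g x| ≤ K) :
    Integrable (fun x => Real.exp (g x)) μ :=
  integrable_of_bounded (Real.measurable_exp.comp hg) (K := Real.exp K) fun x => by
    rw [Real.abs_exp]; exact Real.exp_le_exp.2 (le_of_abs_le (hK x))

namespace GibbsBound

variable {X : Type*} [MeasurableSpace X] {R : ℝ} {μ ν : Measure X}

theorem mono {R' : ℝ} (h : GibbsBound R μ ν) (hR : R ≤ R') : GibbsBound R' μ ν :=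
  fun g hg hK => (h g hg hK).trans (by gcongr)

/-- The bound for the test function `t * 1_A`. -/
theorem mul_measureReal_le [IsProbabilityMeasure μ] [IsProbabilityMeasure ν]
    (h : GibbsBound R μ ν) {A : Set X} (hA : MeasurableSet A) {t : ℝ} (ht : 0 ≤ t) :
    t * μ.real A ≤ R + Real.exp t * ν.real A := by
  have hmeas : Measurable (A.indicator fun _ => t) := measurable_const.indicator hA
  have hb : ∀ x, |A.indicator (fun _ => t) x| ≤ t := fun x => by
    by_cases hx : x ∈ A <;> simp [hx, abs_of_nonneg ht, ht]
  have h1 := h _ hmeas ⟨t, hb⟩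
  rw [integral_indicator_const _ hA, smul_eq_mul, mul_comm] at h1
  have h2 : ∫ x, Real.exp (A.indicator (fun _ => t) x) ∂ν ≤ 1 + Real.exp t * ν.real A := by
    calc ∫ x, Real.exp (A.indicator (fun _ => t) x) ∂ν
        ≤ ∫ x, (1 + A.indicator (fun _ => Real.exp t) x) ∂ν := by
          refine integral_mono (integrable_exp_of_bounded hmeas hb)
            ((integrable_const _).add ((integrable_const _).indicator hA)) fun x => ?_
          by_cases hx : x ∈ A <;> simp [hx]
      _ = 1 + Real.exp t * ν.real A := by
          rw [integral_add (integrable_const _) ((integrable_const _).indicator hA),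
            integral_indicator_const _ hA]
          simp [mul_comm]
  have hpos : 0 < ∫ x, Real.exp (A.indicator (fun _ => t) x) ∂ν :=
    integral_exp_pos (integrable_exp_of_bounded hmeas hb)
  have h3 := Real.log_le_sub_one_of_pos hpos
  linarith

/-- The measures with a given Gibbs bound are uniformly absolutely continuous. -/
theorem exists_measure_le [IsProbabilityMeasure ν] (R : ℝ) {e : ℝ≥0∞} (he : 0 < e) :
    ∃ δ : ℝ≥0∞, 0 < δ ∧ ∀ A, MeasurableSet A → ν A ≤ δ →
      ∀ μ : Measure X, IsProbabilityMeasure μ → GibbsBound R μ ν → μ A ≤ e := by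
  rcases eq_or_ne e ∞ with rfl | hetop
  · exact ⟨1, one_pos, fun _ _ _ _ _ _ => le_top⟩
  have he' : 0 < e.toReal := ENNReal.toReal_pos he.ne' hetop
  set e' := e.toReal with hedef
  let t : ℝ := 2 * |R| / e' + 1
  have ht : 0 < t := by positivity
  have htR : R ≤ t * (e' / 2) := by
    have : t * (e' / 2) = |R| + e' / 2 := by simp only [t]; field_simp
    rw [this]; linarith [le_abs_self R]
  refine ⟨ENNReal.ofReal (Real.exp (-t) * (t * (e' / 2))), by
    rw [ENNReal.ofReal_pos]; positivity, fun A hA hν μ _ h => ?_⟩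
  have h1 := h.mul_measureReal_le hA ht.le
  have h2 : ν.real A ≤ Real.exp (-t) * (t * (e' / 2)) :=
    ENNReal.toReal_le_of_le_ofReal (by positivity) hν
  have h3 : Real.exp t * ν.real A ≤ t * (e' / 2) := by
    calc Real.exp t * ν.real A ≤ Real.exp t * (Real.exp (-t) * (t * (e' / 2))) := by gcongr
      _ = t * (e' / 2) := by rw [← mul_assoc, ← Real.exp_add]; simp
  have h4 : t * μ.real A ≤ t * e' := by linarith
  have h5 : μ.real A ≤ e' := le_of_mul_le_mul_left h4 ht
  exact (ENNReal.toReal_le_toReal (measure_ne_top _ _) hetop).1 h5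

theorem absolutelyContinuous [IsProbabilityMeasure μ] [IsProbabilityMeasure ν]
    (h : GibbsBound R μ ν) : μ ≪ ν := by
  refine Measure.AbsolutelyContinuous.mk fun A hA hν => ?_
  refine le_antisymm (le_of_forall_gt_imp_ge_of_dense fun e he => ?_) zero_le
  obtain ⟨δ, _, hδ⟩ := exists_measure_le (ν := ν) R he
  exact hδ A hA (by simp [hν]) μ inferInstance h

/-- The truncations `max (-N) (min N (log f))` of the logarithm `log f` of the density recover the
divergence by Fatou's lemma. -/
theorem klDiv_le [IsProbabilityMeasure μ] [IsProbabilityMeasure ν] (h : GibbsBound R μ ν) :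
    klDiv μ ν ≤ ENNReal.ofReal R := by
  have hac := h.absolutelyContinuous
  let f : X → ℝ := fun x => (μ.rnDeriv ν x).toReal
  have hf : Measurable f := (Measure.measurable_rnDeriv μ ν).ennreal_toReal
  have hf0 : ∀ x, 0 ≤ f x := fun x => ENNReal.toReal_nonneg
  -- where `f` vanishes, `log f = 0` is a junk value, and the truncation has to be `-N`
  let g : ℕ → X → ℝ := fun N x => if f x < Real.exp (-N) then -N else min N (Real.log (f x))
  have hgm : ∀ N, Measurable (g N) := fun N =>
    Measurable.ite (hf measurableSet_Iio) measurable_const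
      (measurable_const.min (Real.measurable_log.comp hf))
  have hglow : ∀ (N : ℕ) x, -(N : ℝ) ≤ g N x := fun N x => by
    simp only [g]
    split_ifs with hx
    · exact le_rfl
    · push Not at hx
      refine le_min (by linarith [N.cast_nonneg (α := ℝ)]) ?_
      rwa [Real.le_log_iff_exp_le ((Real.exp_pos _).trans_le hx)]
  have hgup : ∀ N x, g N x ≤ N := fun N x => by
    simp only [g]
    split_ifs with hx
    · linarith [N.cast_nonneg (α := ℝ)]
    · exact min_le_left _ _
  have hgb : ∀ N x, |g N x| ≤ N := fun N x => abs_le.2 ⟨hglow N x, hgup N x⟩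
  have hexp : ∀ N x, Real.exp (g N x) ≤ f x + Real.exp (-N) := fun N x => by
    simp only [g]
    split_ifs with hx
    · linarith [hf0 x]
    · push Not at hx
      have hfx : 0 < f x := (Real.exp_pos _).trans_le hx
      have : Real.exp (min (N : ℝ) (Real.log (f x))) ≤ f x := by
        calc _ ≤ Real.exp (Real.log (f x)) := Real.exp_le_exp.2 (min_le_right _ _)
          _ = f x := Real.exp_log hfx
      linarith [Real.exp_pos (-(N : ℝ))]
  have hfint : Integrable f ν := Measure.integrable_toReal_rnDeriv
  have hf1 : ∫ x, f x ∂ν = 1 := by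
    have := Measure.integral_toReal_rnDeriv hac
    simpa [f] using this
  have hbound : ∀ N : ℕ, ∫ x, g N x ∂μ ≤ R + Real.exp (-N) := fun N => by
    have h1 := h (g N) (hgm N) ⟨N, hgb N⟩
    have hi := integrable_exp_of_bounded (μ := ν) (hgm N) (hgb N)
    have h2 : ∫ x, Real.exp (g N x) ∂ν ≤ 1 + Real.exp (-N) := by
      calc ∫ x, Real.exp (g N x) ∂ν ≤ ∫ x, (f x + Real.exp (-N)) ∂ν :=
            integral_mono hi (hfint.add (integrable_const _)) (hexp N)
        _ = 1 + Real.exp (-N) := by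
            rw [integral_add hfint (integrable_const _), hf1]; simp
    have h3 := Real.log_le_sub_one_of_pos (integral_exp_pos hi)
    linarith
  have hdens : ∀ N, ∫ x, f x * g N x ∂ν = ∫ x, g N x ∂μ := fun N => by
    rw [← integral_rnDeriv_smul hac]
    rfl
  have hfg : ∀ N, Integrable (fun x => f x * g N x) ν := fun N =>
    hfint.mul_bdd (c := N) (hgm N).aestronglyMeasurable (ae_of_all _ (hgb N))
  have hnn : ∀ N : ℕ, 1 ≤ N → ∀ x, 0 ≤ f x * g N x - f x + 1 := fun N hN x => by
    have hN' : (1 : ℝ) ≤ N := by exact_mod_cast hN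
    simp only [g]
    split_ifs with hx
    · have h1 : Real.exp (N : ℝ) * f x ≤ 1 := by
        calc Real.exp (N : ℝ) * f x ≤ Real.exp N * Real.exp (-N) := by gcongr
          _ = 1 := by rw [← Real.exp_add]; simp
      have h2 : ((N : ℝ) + 1) * f x ≤ Real.exp N * f x :=
        mul_le_mul_of_nonneg_right (Real.add_one_le_exp _) (hf0 x)
      linarith
    · push Not at hx
      have hfx : 0 < f x := (Real.exp_pos _).trans_le hx
      rcases min_choice (N : ℝ) (Real.log (f x)) with hm | hm <;> rw [hm]
      · nlinarith
      · have := klFun_nonneg hfx.le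
        rw [klFun_apply] at this
        linarith
  have hlim : ∀ x, Tendsto (fun N : ℕ => ENNReal.ofReal (f x * g N x - f x + 1)) atTop
      (𝓝 (ENNReal.ofReal (klFun (f x)))) := fun x => by
    refine ENNReal.tendsto_ofReal ?_
    rcases (hf0 x).eq_or_lt with h0 | h0
    · rw [← h0, klFun_zero]; simp
    · refine tendsto_const_nhds.congr' ?_
      have e1 : ∀ᶠ N : ℕ in atTop, Real.exp (-(N : ℝ)) ≤ f x := by
        have : Tendsto (fun N : ℕ => Real.exp (-(N : ℝ))) atTop (𝓝 0) :=
          Real.tendsto_exp_neg_atTop_nhds_zero.comp tendsto_natCast_atTop_atTop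
        exact (this.eventually_lt_const h0).mono fun _ => le_of_lt
      have e2 : ∀ᶠ N : ℕ in atTop, Real.log (f x) ≤ N :=
        tendsto_natCast_atTop_atTop.eventually_ge_atTop _
      filter_upwards [e1, e2] with N h1 h2
      simp only [g]
      rw [if_neg (not_lt.2 h1), min_eq_right h2, klFun_apply]
      ring
  rw [klDiv_eq_lintegral_klFun_of_ac hac]
  calc ∫⁻ x, ENNReal.ofReal (klFun (f x)) ∂ν
      = ∫⁻ x, liminf (fun N : ℕ => ENNReal.ofReal (f x * g N x - f x + 1)) atTop ∂ν :=
        lintegral_congr fun x => (hlim x).liminf_eq.symm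
    _ ≤ liminf (fun N : ℕ => ∫⁻ x, ENNReal.ofReal (f x * g N x - f x + 1) ∂ν) atTop :=
        lintegral_liminf_le fun N =>
          (((hf.mul (hgm N)).sub hf).add measurable_const).ennreal_ofReal
    _ ≤ liminf (fun N : ℕ => ENNReal.ofReal (R + Real.exp (-N))) atTop := by
        refine liminf_le_liminf ?_
        filter_upwards [eventually_ge_atTop 1] with N hN
        have hsub : Integrable (fun x => f x * g N x - f x) ν := (hfg N).sub hfint
        have hi : Integrable (fun x => f x * g N x - f x + 1) ν := hsub.add (integrable_const _)
        rw [← ofReal_integral_eq_lintegral_ofReal hi (ae_of_all _ (hnn N hN))]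
        refine ENNReal.ofReal_le_ofReal ?_
        have hsplit : ∫ x, (f x * g N x - f x + 1) ∂ν = ∫ x, g N x ∂μ := by
          rw [integral_add hsub (integrable_const _), integral_sub (hfg N) hfint,
            hf1, hdens]
          simp
        exact hsplit.trans_le (hbound N)
    _ = ENNReal.ofReal R := by
        refine Tendsto.liminf_eq (ENNReal.tendsto_ofReal ?_)
        have : Tendsto (fun N : ℕ => Real.exp (-(N : ℝ))) atTop (𝓝 0) :=
          Real.tendsto_exp_neg_atTop_nhds_zero.comp tendsto_natCast_atTop_atTop
        simpa using this.const_add R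

end GibbsBound

/-! ### Divergence of a kernel from a constant kernel -/

section Density

variable {α β : Type*} [MeasurableSpace α] [MeasurableSpace β]
  [MeasurableSpace.CountableOrCountablyGenerated α β]

theorem lintegral_kernelRnDeriv_le_one (Q : Kernel α β) [IsMarkovKernel Q] (P : Measure β)
    [IsProbabilityMeasure P] (a : α) :
    ∫⁻ b, Kernel.rnDeriv Q (Kernel.const α P) a b ∂P ≤ 1 := by
  have := Kernel.setLIntegral_rnDeriv_le (κ := Q) (η := Kernel.const α P) (a := a)
    (s := Set.univ)
  simpa using this

variable {σ : Measure α} [IsProbabilityMeasure σ] {Q : Kernel α β} [IsMarkovKernel Q]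
  {P : Measure β} [IsProbabilityMeasure P]

theorem compProd_absolutelyContinuous_prod_iff :
    σ ⊗ₘ Q ≪ σ.prod P ↔ ∀ᵐ a ∂σ, Q a ≪ P := by
  rw [← Measure.compProd_const, Measure.absolutelyContinuous_compProd_right_iff]
  simp

theorem withDensity_kernelRnDeriv {a : α} (h : Q a ≪ P) :
    P.withDensity (Kernel.rnDeriv Q (Kernel.const α P) a) = Q a := by
  have := Kernel.withDensity_rnDeriv_eq (κ := Q) (η := Kernel.const α P) (a := a) (by simpa using h)
  rwa [Kernel.withDensity_apply _ (Kernel.measurable_rnDeriv _ _), Kernel.const_apply] at this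

theorem compProd_eq_withDensity (h : σ ⊗ₘ Q ≪ σ.prod P) :
    σ ⊗ₘ Q = (σ.prod P).withDensity
      fun p => Kernel.rnDeriv Q (Kernel.const α P) p.1 p.2 := by
  have hk := Kernel.measurable_rnDeriv Q (Kernel.const α P)
  ext A hA
  rw [Measure.compProd_apply hA, withDensity_apply _ hA, ← lintegral_indicator hA,
    lintegral_prod _ (hk.indicator hA).aemeasurable]
  refine lintegral_congr_ae ?_
  filter_upwards [compProd_absolutelyContinuous_prod_iff.1 h] with a ha
  have hs : MeasurableSet (Prod.mk a ⁻¹' A) := measurable_prodMk_left hA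
  rw [← withDensity_kernelRnDeriv ha, withDensity_apply _ hs, ← lintegral_indicator hs]
  rfl

theorem klDiv_eq_lintegral_kernelRnDeriv {a : α} (h : Q a ≪ P) :
    klDiv (Q a) P
      = ∫⁻ b, ENNReal.ofReal (klFun (Kernel.rnDeriv Q (Kernel.const α P) a b).toReal) ∂P := by
  rw [klDiv_eq_lintegral_klFun_of_ac h]
  refine lintegral_congr_ae ?_
  have := Kernel.rnDeriv_eq_rnDeriv_measure (κ := Q) (η := Kernel.const α P) (a := a)
  rw [Kernel.const_apply] at this
  filter_upwards [this] with b hb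
  rw [hb]

theorem measurableSet_kernel_absolutelyContinuous : MeasurableSet {a | Q a ≪ P} := by
  simpa using Kernel.measurableSet_absolutelyContinuous Q (Kernel.const α P)

variable (Q P) in
theorem measurable_klDiv_kernel : Measurable fun a => klDiv (Q a) P := by
  classical
  have hm : Measurable fun p : α × β =>
      ENNReal.ofReal (klFun (Kernel.rnDeriv Q (Kernel.const α P) p.1 p.2).toReal) :=
    (measurable_klFun.comp (Kernel.measurable_rnDeriv _ _).ennreal_toReal).ennreal_ofReal
  have e : (fun a => klDiv (Q a) P) = fun a => if a ∈ {a | Q a ≪ P} then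
      ∫⁻ b, ENNReal.ofReal (klFun (Kernel.rnDeriv Q (Kernel.const α P) a b).toReal) ∂P else ∞ := by
    ext a
    split_ifs with h
    · exact klDiv_eq_lintegral_kernelRnDeriv h
    · exact klDiv_of_not_ac h
  rw [e]
  exact Measurable.ite measurableSet_kernel_absolutelyContinuous hm.lintegral_prod_right'
    measurable_const

/-- The chain rule for the Kullback-Leibler divergence with a constant reference kernel. -/
theorem lintegral_klDiv_eq : ∫⁻ a, klDiv (Q a) P ∂σ = klDiv (σ ⊗ₘ Q) (σ.prod P) := by
  by_cases h : σ ⊗ₘ Q ≪ σ.prod P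
  · have hk := Kernel.measurable_rnDeriv Q (Kernel.const α P)
    have hae := compProd_absolutelyContinuous_prod_iff.1 h
    have e1 : (σ ⊗ₘ Q).rnDeriv (σ.prod P) =ᵐ[σ.prod P]
        fun p => Kernel.rnDeriv Q (Kernel.const α P) p.1 p.2 := by
      have := Measure.rnDeriv_withDensity (σ.prod P) hk
      rwa [← compProd_eq_withDensity h] at this
    rw [klDiv_eq_lintegral_klFun_of_ac h]
    have e2 : ∫⁻ p, ENNReal.ofReal (klFun ((σ ⊗ₘ Q).rnDeriv (σ.prod P) p).toReal) ∂(σ.prod P)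
        = ∫⁻ p, ENNReal.ofReal (klFun (Kernel.rnDeriv Q (Kernel.const α P) p.1 p.2).toReal)
          ∂(σ.prod P) :=
      lintegral_congr_ae (e1.mono fun p hp => by simp only [hp])
    have hm : Measurable fun p : α × β =>
        ENNReal.ofReal (klFun (Kernel.rnDeriv Q (Kernel.const α P) p.1 p.2).toReal) :=
      (measurable_klFun.comp hk.ennreal_toReal).ennreal_ofReal
    rw [e2, lintegral_prod _ hm.aemeasurable]
    refine lintegral_congr_ae ?_
    filter_upwards [hae] with a ha
    exact klDiv_eq_lintegral_kernelRnDeriv ha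
  · rw [klDiv_of_not_ac h]
    have hm : MeasurableSet {a | Q a ≪ P} := measurableSet_kernel_absolutelyContinuous
    have hpos : σ {a | Q a ≪ P}ᶜ ≠ 0 := fun h0 =>
      h (compProd_absolutelyContinuous_prod_iff.2 (by rw [ae_iff]; exact h0))
    refine top_le_iff.1 ?_
    calc (∞ : ℝ≥0∞) = ∫⁻ _ in {a | Q a ≪ P}ᶜ, ∞ ∂σ := by
          rw [setLIntegral_const, ENNReal.top_mul hpos]
      _ = ∫⁻ a in {a | Q a ≪ P}ᶜ, klDiv (Q a) P ∂σ := by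
          refine setLIntegral_congr_fun hm.compl fun a ha => ?_
          exact (klDiv_of_not_ac ha).symm
      _ ≤ ∫⁻ a, klDiv (Q a) P ∂σ := setLIntegral_le_lintegral _ _

end Density

/-! ### The posterior loss of a model -/

namespace Problem

variable {C Z H : Type*} [MeasurableSpace C] [MeasurableSpace Z] [MeasurableSpace H]

/-- The expected loss `E_{z ∼ c} ℓ_c(h, z)` of a single model, as an extended nonnegative number. -/
noncomputable def modelLoss (𝓒 : Problem C Z H) (c : C) (h : H) : ℝ≥0∞ :=
  ∫⁻ z, ENNReal.ofReal (𝓒.loss c h z) ∂(𝓒.sample c)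

theorem measurable_modelLoss (𝓒 : Problem C Z H) :
    Measurable fun x : C × H => 𝓒.modelLoss x.1 x.2 := by
  have hm : Measurable fun y : (C × H) × Z => ENNReal.ofReal (𝓒.loss y.1.1 y.1.2 y.2) :=
    (𝓒.measurable_loss.comp (by fun_prop :
      Measurable fun y : (C × H) × Z => (y.1.1, y.1.2, y.2))).ennreal_ofReal
  exact hm.lintegral_kernel_prod_right' (κ := 𝓒.sample.comap Prod.fst measurable_fst)

theorem modelLoss_le_one (𝓒 : Problem C Z H) (c : C) (h : H) : 𝓒.modelLoss c h ≤ 1 := by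
  calc 𝓒.modelLoss c h ≤ ∫⁻ _, 1 ∂(𝓒.sample c) :=
        lintegral_mono fun z => ENNReal.ofReal_le_one.2 (𝓒.loss_mem c h z).2
    _ = 1 := by simp

theorem lintegral_modelLoss_le_one (𝓒 : Problem C Z H) (c : C) (q : Measure H)
    [IsProbabilityMeasure q] : ∫⁻ h, 𝓒.modelLoss c h ∂q ≤ 1 := by
  calc ∫⁻ h, 𝓒.modelLoss c h ∂q ≤ ∫⁻ _, 1 ∂q := lintegral_mono fun h => 𝓒.modelLoss_le_one c h
    _ = 1 := by simp

theorem trueLoss_eq (𝓒 : Problem C Z H) (c : C) (q : Measure H) [IsProbabilityMeasure q] :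
    𝓒.trueLoss c q = (∫⁻ h, 𝓒.modelLoss c h ∂q).toReal := by
  have hm : Measurable fun y : Z × H => 𝓒.loss c y.2 y.1 :=
    𝓒.measurable_loss.comp (by fun_prop : Measurable fun y : Z × H => (c, y.2, y.1))
  have hinner : ∀ z, ∫ h, 𝓒.loss c h z ∂q = (∫⁻ h, ENNReal.ofReal (𝓒.loss c h z) ∂q).toReal :=
    fun z => integral_eq_lintegral_of_nonneg_ae (ae_of_all _ fun h => (𝓒.loss_mem c h z).1)
      (hm.comp measurable_prodMk_left).aestronglyMeasurable
  have hfin : ∀ z, ∫⁻ h, ENNReal.ofReal (𝓒.loss c h z) ∂q ≠ ∞ := fun z => by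
    refine ne_top_of_le_ne_top ENNReal.one_ne_top ?_
    calc ∫⁻ h, ENNReal.ofReal (𝓒.loss c h z) ∂q ≤ ∫⁻ _, 1 ∂q :=
          lintegral_mono fun h => ENNReal.ofReal_le_one.2 (𝓒.loss_mem c h z).2
      _ = 1 := by simp
  unfold trueLoss
  rw [integral_eq_lintegral_of_nonneg_ae
    (ae_of_all _ fun z => integral_nonneg fun h => (𝓒.loss_mem c h z).1)
    hm.stronglyMeasurable.integral_prod_right'.aestronglyMeasurable]
  congr 1
  simp_rw [hinner, fun z => ENNReal.ofReal_toReal (hfin z)]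
  rw [lintegral_lintegral_swap hm.ennreal_ofReal.aemeasurable]
  rfl

theorem measurable_lintegral_modelLoss (𝓒 : Problem C Z H) (Q : Kernel 𝓒.Dataset H)
    [IsMarkovKernel Q] :
    Measurable fun x : C × 𝓒.Dataset => ∫⁻ h, 𝓒.modelLoss x.1 h ∂(Q x.2) := by
  have hm : Measurable fun y : (C × 𝓒.Dataset) × H => 𝓒.modelLoss y.1.1 y.2 :=
    𝓒.measurable_modelLoss.comp (by fun_prop :
      Measurable fun y : (C × 𝓒.Dataset) × H => (y.1.1, y.2))
  exact hm.lintegral_kernel_prod_right' (κ := Q.comap Prod.snd measurable_snd)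

theorem integrable_trueLoss (𝓒 : Problem C Z H) (Q : Kernel 𝓒.Dataset H) [IsMarkovKernel Q] :
    Integrable (fun x => 𝓒.trueLoss x.1 (Q x.2)) 𝓒.jointLaw := by
  simp_rw [fun x : C × 𝓒.Dataset => 𝓒.trueLoss_eq x.1 (Q x.2)]
  refine integrable_of_bounded (𝓒.measurable_lintegral_modelLoss Q).ennreal_toReal (K := 1)
    fun x => ?_
  rw [abs_of_nonneg ENNReal.toReal_nonneg]
  exact ENNReal.toReal_le_of_le_ofReal zero_le_one
    (by simpa using 𝓒.lintegral_modelLoss_le_one x.1 (Q x.2))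

/-- The expected true loss of the transmitter's own belief. -/
noncomputable def baseLoss (𝓒 : Problem C Z H) : ℝ :=
  ∫ x, 𝓒.trueLoss x.1 (𝓒.belief x.2) ∂𝓒.jointLaw

/-- `ρ` is the conditional expectation of the loss of a model given the dataset: a single-letter
distortion function on pairs (dataset, model) that represents `dSem` on the kernels that are
absolutely continuous with respect to `P`. -/
structure IsPosteriorLoss (𝓒 : Problem C Z H) (P : Measure H) (ρ : 𝓒.Dataset × H → ℝ) : Prop where
  measurable : Measurable ρ
  mem_Icc : ∀ p, ρ p ∈ Set.Icc (0 : ℝ) 1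
  dSem_eq : ∀ Q : Kernel 𝓒.Dataset H, IsMarkovKernel Q → 𝓒.dataLaw ⊗ₘ Q ≪ 𝓒.dataLaw.prod P →
    𝓒.dSem 𝓒.belief Q = ∫ p, ρ p ∂(𝓒.dataLaw ⊗ₘ Q) - 𝓒.baseLoss

theorem IsPosteriorLoss.abs_le_one {𝓒 : Problem C Z H} {P : Measure H} {ρ : 𝓒.Dataset × H → ℝ}
    (hρ : 𝓒.IsPosteriorLoss P ρ) (y : 𝓒.Dataset × H) : |ρ y| ≤ 1 := by
  rw [abs_of_nonneg (hρ.mem_Icc y).1]; exact (hρ.mem_Icc y).2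

/-- A posterior loss exists although the conditional law of the concept given the dataset need not
exist as a kernel: it is the density with respect to `dataLaw.prod P` of the loss-weighted law of
(dataset, model). -/
theorem exists_isPosteriorLoss [MeasurableSpace.CountablyGenerated H] (𝓒 : Problem C Z H)
    (P : Measure H) [IsProbabilityMeasure P] : ∃ ρ, 𝓒.IsPosteriorLoss P ρ := by
  let π : (C × 𝓒.Dataset) × H → 𝓒.Dataset × H := fun q => (q.1.2, q.2)
  have hπ : Measurable π := by fun_prop
  let η := 𝓒.jointLaw.prod P
  let ν := 𝓒.dataLaw.prod P
  let w : (C × 𝓒.Dataset) × H → ℝ≥0∞ := fun q => 𝓒.modelLoss q.1.1 q.2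
  have hw : Measurable w := 𝓒.measurable_modelLoss.comp (by fun_prop :
    Measurable fun y : (C × 𝓒.Dataset) × H => (y.1.1, y.2))
  have hηπ : η.map π = ν := by
    have h1 := Measure.map_prod_map 𝓒.jointLaw P (measurable_snd (α := C) (β := 𝓒.Dataset))
      measurable_id
    rw [Measure.map_id] at h1
    exact h1.symm
  let Λ := (η.withDensity w).map π
  have hΛ : Λ ≤ ν := by
    have h1 : η.withDensity w ≤ η := by
      calc η.withDensity w ≤ η.withDensity 1 :=
            withDensity_mono (ae_of_all _ fun q => 𝓒.modelLoss_le_one q.1.1 q.2)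
        _ = η := withDensity_one
    exact (Measure.map_mono h1 hπ).trans_eq hηπ
  have : IsFiniteMeasure Λ := isFiniteMeasure_of_le ν hΛ
  let ρ₀ := Λ.rnDeriv ν
  have hρ₀ : Measurable ρ₀ := Measure.measurable_rnDeriv _ _
  have hρ₀1 : ρ₀ ≤ᵐ[ν] 1 := Measure.rnDeriv_le_one_of_le hΛ
  have hΛeq : ν.withDensity ρ₀ = Λ :=
    Measure.withDensity_rnDeriv_eq _ _ (Measure.absolutelyContinuous_of_le hΛ)
  have hpair : ∀ f : 𝓒.Dataset × H → ℝ≥0∞, Measurable f →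
      ∫⁻ q, w q * f (π q) ∂η = ∫⁻ p, ρ₀ p * f p ∂ν := by
    intro f hf
    have h1 : ∫⁻ p, f p ∂Λ = ∫⁻ q, w q * f (π q) ∂η := by
      have hfπ : Measurable fun q => f (π q) := hf.comp hπ
      rw [lintegral_map hf hπ, lintegral_withDensity_eq_lintegral_mul _ hw hfπ]
      rfl
    rw [← h1, ← hΛeq, lintegral_withDensity_eq_lintegral_mul _ hρ₀ hf]
    rfl
  refine ⟨fun p => (min (ρ₀ p) 1).toReal, (hρ₀.min measurable_const).ennreal_toReal,
    fun p => ⟨ENNReal.toReal_nonneg, ENNReal.toReal_le_of_le_ofReal zero_le_one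
      (by simp)⟩, fun Q _ hQ => ?_⟩
  have hk := Kernel.measurable_rnDeriv Q (Kernel.const 𝓒.Dataset P)
  have hae : ∀ᵐ x ∂𝓒.jointLaw, Q x.2 ≪ P := by
    have := compProd_absolutelyContinuous_prod_iff.1 hQ
    exact ae_of_ae_map measurable_snd.aemeasurable this
  have hkey : ∫⁻ x, ∫⁻ h, 𝓒.modelLoss x.1 h ∂(Q x.2) ∂𝓒.jointLaw
      = ∫⁻ p, ρ₀ p ∂(𝓒.dataLaw ⊗ₘ Q) := by
    calc ∫⁻ x, ∫⁻ h, 𝓒.modelLoss x.1 h ∂(Q x.2) ∂𝓒.jointLaw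
        = ∫⁻ x, ∫⁻ h, w (x, h) * Kernel.rnDeriv Q (Kernel.const _ P) x.2 h ∂P ∂𝓒.jointLaw := by
          refine lintegral_congr_ae ?_
          filter_upwards [hae] with x hx
          have hx1 : Measurable fun h => 𝓒.modelLoss x.1 h :=
            𝓒.measurable_modelLoss.comp measurable_prodMk_left
          conv_lhs => rw [← withDensity_kernelRnDeriv hx]
          rw [lintegral_withDensity_eq_lintegral_mul _ (Kernel.measurable_rnDeriv_right _ _ _) hx1]
          exact lintegral_congr fun h => mul_comm _ _
      _ = ∫⁻ q, w q * Kernel.rnDeriv Q (Kernel.const _ P) q.1.2 q.2 ∂η := by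
          have hm : Measurable fun q : (C × 𝓒.Dataset) × H =>
              w q * Kernel.rnDeriv Q (Kernel.const _ P) q.1.2 q.2 := hw.mul (hk.comp hπ)
          exact (lintegral_prod _ hm.aemeasurable).symm
      _ = ∫⁻ p, ρ₀ p * Kernel.rnDeriv Q (Kernel.const _ P) p.1 p.2 ∂ν := hpair _ hk
      _ = ∫⁻ p, ρ₀ p ∂(𝓒.dataLaw ⊗ₘ Q) := by
          rw [compProd_eq_withDensity hQ, lintegral_withDensity_eq_lintegral_mul _ hk hρ₀]
          exact lintegral_congr fun p => mul_comm _ _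
  have h1 : ∫ x, 𝓒.trueLoss x.1 (Q x.2) ∂𝓒.jointLaw
      = (∫⁻ x, ∫⁻ h, 𝓒.modelLoss x.1 h ∂(Q x.2) ∂𝓒.jointLaw).toReal := by
    simp_rw [fun x : C × 𝓒.Dataset => 𝓒.trueLoss_eq x.1 (Q x.2)]
    exact integral_toReal (𝓒.measurable_lintegral_modelLoss Q).aemeasurable
      (ae_of_all _ fun x => (𝓒.lintegral_modelLoss_le_one x.1 (Q x.2)).trans_lt ENNReal.one_lt_top)
  have h2 : ∫ p, (min (ρ₀ p) 1).toReal ∂(𝓒.dataLaw ⊗ₘ Q)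
      = (∫⁻ p, ρ₀ p ∂(𝓒.dataLaw ⊗ₘ Q)).toReal := by
    rw [integral_toReal (hρ₀.min measurable_const).aemeasurable
      (ae_of_all _ fun p => (min_le_right _ _).trans_lt ENNReal.one_lt_top)]
    congr 1
    refine lintegral_congr_ae ?_
    filter_upwards [hQ.ae_le hρ₀1] with p hp
    exact min_eq_left hp
  unfold dSem baseLoss
  rw [integral_sub (𝓒.integrable_trueLoss Q) (𝓒.integrable_trueLoss 𝓒.belief), h1, h2, hkey]

end Problem

/-! ### The Gibbs bound of a code -/

namespace Problem
namespace Code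

variable {C Z H : Type*} [MeasurableSpace C] [MeasurableSpace Z] [MeasurableSpace H]
  {𝓒 : Problem C Z H} {P : Measure H} {n : ℕ}

theorem measurable_out (c : Code 𝓒 P n) (i : Fin n) :
    Measurable fun x : (Fin n → 𝓒.Dataset) × c.Ω => (x.1 i, c.dec (c.enc x) x.2 i) := by
  have h1 : Measurable fun y : ℕ × c.Ω => c.cand y.1 y.2 :=
    measurable_from_prod_countable_right fun k => c.measurable_cand k
  have h2 : Measurable fun x : (Fin n → 𝓒.Dataset) × c.Ω => c.cand (c.enc x) x.2 :=
    h1.comp (c.measurable_enc.prodMk measurable_snd)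
  exact ((measurable_pi_apply i).comp measurable_fst).prodMk ((measurable_pi_apply i).comp h2)

theorem measurable_pairs (c : Code 𝓒 P n) (k : ℕ) :
    Measurable fun (x : (Fin n → 𝓒.Dataset) × c.Ω) (i : Fin n) => (x.1 i, c.cand k x.2 i) :=
  measurable_pi_lambda _ fun i => ((measurable_pi_apply i).comp measurable_fst).prodMk
    ((measurable_pi_apply i).comp ((c.measurable_cand k).comp measurable_snd))

/-- Each fixed candidate is independent of the datasets. -/
theorem map_pairs [IsProbabilityMeasure P] (c : Code 𝓒 P n) (k : ℕ) :
    c.inputLaw.map (fun x i => (x.1 i, c.cand k x.2 i))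
      = Measure.pi fun _ : Fin n => 𝓒.dataLaw.prod P := by
  have h1 : c.inputLaw.map (Prod.map id (c.cand k))
      = (Measure.pi fun _ : Fin n => 𝓒.dataLaw).prod (Measure.pi fun _ : Fin n => P) := by
    have := Measure.map_prod_map (Measure.pi fun _ : Fin n => 𝓒.dataLaw) c.p measurable_id
      (c.measurable_cand k)
    rw [Measure.map_id, c.map_cand] at this
    exact this.symm
  have h2 := (measurePreserving_arrowProdEquivProdArrow 𝓒.Dataset H (Fin n)
    (fun _ => 𝓒.dataLaw) (fun _ => P)).symm.map_eq
  rw [← h2, ← h1, Measure.map_map (MeasurableEquiv.measurable _)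
    (measurable_id.prodMap (c.measurable_cand k))]
  rfl

instance (c : Code 𝓒 P n) (i : Fin n) : IsProbabilityMeasure (c.outJoint i) :=
  Measure.isProbabilityMeasure_map (c.measurable_out i).aemeasurable

theorem fst_outJoint (c : Code 𝓒 P n) (i : Fin n) : (c.outJoint i).fst = 𝓒.dataLaw := by
  unfold outJoint inputLaw
  rw [Measure.fst, Measure.map_map measurable_fst (c.measurable_out i)]
  have h1 : (Measure.pi fun _ : Fin n => 𝓒.dataLaw).map (fun s => s i) = 𝓒.dataLaw :=
    (measurePreserving_eval (fun _ : Fin n => 𝓒.dataLaw) i).map_eq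
  have h2 : ((Measure.pi fun _ : Fin n => 𝓒.dataLaw).prod c.p).map Prod.fst
      = Measure.pi fun _ : Fin n => 𝓒.dataLaw := measurePreserving_fst.map_eq
  conv_rhs => rw [← h1, ← h2]
  rw [Measure.map_map (measurable_pi_apply i) measurable_fst]
  rfl

/-- The joint law of a dataset and the decoder's output. -/
theorem dataLaw_compProd_outBelief [StandardBorelSpace H] [Nonempty H] (c : Code 𝓒 P n)
    (i : Fin n) : 𝓒.dataLaw ⊗ₘ c.outBelief i = c.outJoint i := by
  rw [← c.fst_outJoint i]
  exact (c.outJoint i).disintegrate (c.outJoint i).condKernel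

theorem outJoint_absolutelyContinuous [IsProbabilityMeasure P] (c : Code 𝓒 P n) (i : Fin n) :
    c.outJoint i ≪ 𝓒.dataLaw.prod P := by
  refine Measure.AbsolutelyContinuous.mk fun A hA h0 => ?_
  rw [outJoint, Measure.map_apply (c.measurable_out i) hA]
  refine measure_mono_null (t := ⋃ k, {x | (x.1 i, c.cand k x.2 i) ∈ A})
    (fun x hx => Set.mem_iUnion.2 ⟨c.enc x, hx⟩) (measure_iUnion_null fun k => ?_)
  have h1 : Measure.map (fun x => (x.1 i, c.cand k x.2 i)) c.inputLaw = 𝓒.dataLaw.prod P := by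
    rw [← (measurePreserving_eval (fun _ : Fin n => 𝓒.dataLaw.prod P) i).map_eq,
      ← c.map_pairs k, Measure.map_map (measurable_pi_apply i) (c.measurable_pairs k)]
    rfl
  have h2 : Measurable fun x : (Fin n → 𝓒.Dataset) × c.Ω => (x.1 i, c.cand k x.2 i) :=
    (measurable_pi_apply i).comp (c.measurable_pairs k)
  change c.inputLaw ((fun x => (x.1 i, c.cand k x.2 i)) ⁻¹' A) = 0
  rw [← Measure.map_apply h2 hA, h1, h0]

/-- The average over the positions of the joint law of a dataset and the decoder's output. -/
noncomputable def avgJoint (c : Code 𝓒 P n) : Measure (𝓒.Dataset × H) :=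
  (n : ℝ≥0∞)⁻¹ • ∑ i, c.outJoint i

theorem isProbabilityMeasure_avgJoint (c : Code 𝓒 P n) (hn : n ≠ 0) :
    IsProbabilityMeasure c.avgJoint := by
  refine ⟨?_⟩
  simp only [avgJoint, Measure.smul_apply, Measure.finsetSum_apply, measure_univ, smul_eq_mul,
    Finset.sum_const, Finset.card_univ, Fintype.card_fin, nsmul_eq_mul, mul_one]
  exact ENNReal.inv_mul_cancel (by exact_mod_cast hn) (ENNReal.natCast_ne_top n)

theorem fst_avgJoint (c : Code 𝓒 P n) (hn : n ≠ 0) : c.avgJoint.fst = 𝓒.dataLaw := by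
  ext A hA
  have h1 : ∀ i, c.outJoint i (Prod.fst ⁻¹' A) = 𝓒.dataLaw A := fun i => by
    rw [← c.fst_outJoint i, Measure.fst_apply hA]
  rw [Measure.fst_apply hA]
  simp only [avgJoint, Measure.smul_apply, Measure.finsetSum_apply, h1, smul_eq_mul,
    Finset.sum_const, Finset.card_univ, Fintype.card_fin, nsmul_eq_mul]
  rw [← mul_assoc, ENNReal.inv_mul_cancel (by exact_mod_cast hn) (ENNReal.natCast_ne_top n),
    one_mul]

theorem integral_avgJoint (c : Code 𝓒 P n) {g : 𝓒.Dataset × H → ℝ} (hg : Measurable g) {K : ℝ}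
    (hK : ∀ y, |g y| ≤ K) :
    ∫ y, g y ∂c.avgJoint = (1 / (n : ℝ)) * ∑ i, ∫ y, g y ∂(c.outJoint i) := by
  rw [avgJoint, integral_smul_measure, integral_finsetSum_measure
    fun i _ => integrable_of_bounded hg hK]
  simp

/-- The converse for codes. If the index `k` costs `b k` nats and these costs satisfy Kraft's
inequality, the average output law satisfies the Gibbs bound with the mean cost per position. By
Jensen's inequality `E[G - b K] ≤ log E[exp (G - b K)]` where `G` is the sum of `g` over the
positions; bounding the selected candidate by the sum over all of them leaves independent pairs. -/
theorem gibbsBound_avgJoint [IsProbabilityMeasure P] (c : Code 𝓒 P n) (hn : n ≠ 0)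
    {a : ℕ → ℝ≥0∞} (ha : ∑' k, a k ≤ 1) {b : ℕ → ℝ} (hb : ∀ k, 0 ≤ b k)
    (hab : ∀ x, ENNReal.ofReal (Real.exp (-b (c.enc x))) ≤ a (c.enc x))
    (hint : Integrable (fun x => b (c.enc x)) c.inputLaw) :
    GibbsBound ((∫ x, b (c.enc x) ∂c.inputLaw) / n) c.avgJoint (𝓒.dataLaw.prod P) := by
  rintro g hg ⟨K, hK⟩
  set ν := 𝓒.dataLaw.prod P
  set κ : ℝ := ∫ y, Real.exp (g y) ∂ν with hκ
  have hgexp : Integrable (fun y => Real.exp (g y)) ν := integrable_exp_of_bounded hg hK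
  have hκpos : 0 < κ := integral_exp_pos hgexp
  let S : (Fin n → 𝓒.Dataset × H) → ℝ := fun y => ∑ i, g (y i)
  have hS : Measurable S := by
    refine Finset.measurable_sum _ fun i _ => hg.comp (measurable_pi_apply i)
  have hSb : ∀ y, |S y| ≤ n * K := fun y => by
    calc |S y| ≤ ∑ i, |g (y i)| := Finset.abs_sum_le_sum_abs _ _
      _ ≤ ∑ _i : Fin n, K := Finset.sum_le_sum fun i _ => hK _
      _ = n * K := by simp
  have hSexp : ∫⁻ y, ENNReal.ofReal (Real.exp (S y)) ∂(Measure.pi fun _ : Fin n => ν)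
      = ENNReal.ofReal (κ ^ n) := by
    rw [← ofReal_integral_eq_lintegral_ofReal (integrable_exp_of_bounded hS hSb)
      (ae_of_all _ fun _ => (Real.exp_pos _).le)]
    congr 1
    have := integral_fintype_prod_eq_pow (ι := Fin n) (μ := ν) (fun y => Real.exp (g y))
    simp only [Fintype.card_fin] at this
    rw [hκ, ← this]
    exact integral_congr_ae (ae_of_all _ fun y => Real.exp_sum _ _)
  let G : (Fin n → 𝓒.Dataset) × c.Ω → ℝ := fun x => ∑ i, g (x.1 i, c.dec (c.enc x) x.2 i)
  have hgi : ∀ i, Measurable fun x : (Fin n → 𝓒.Dataset) × c.Ω =>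
      g (x.1 i, c.dec (c.enc x) x.2 i) := fun i => hg.comp (c.measurable_out i)
  have hG : Measurable G := Finset.measurable_sum _ fun i _ => hgi i
  have hGb : ∀ x, |G x| ≤ n * K := fun x => hSb fun i => (x.1 i, c.dec (c.enc x) x.2 i)
  have hbm : Measurable fun x => b (c.enc x) := (measurable_from_top (f := b)).comp c.measurable_enc
  have hYint : Integrable (fun x => G x - b (c.enc x)) c.inputLaw :=
    (integrable_of_bounded hG hGb).sub hint
  have hYm : Measurable fun x => Real.exp (G x - b (c.enc x)) := (hG.sub hbm).exp
  have hYexp : Integrable (fun x => Real.exp (G x - b (c.enc x))) c.inputLaw :=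
    integrable_of_bounded hYm (K := Real.exp (n * K)) fun x => by
      rw [Real.abs_exp]
      exact Real.exp_le_exp.2 (by linarith [hb (c.enc x), le_of_abs_le (hGb x)])
  have hjensen : Real.exp (∫ x, (G x - b (c.enc x)) ∂c.inputLaw)
      ≤ ∫ x, Real.exp (G x - b (c.enc x)) ∂c.inputLaw :=
    convexOn_exp.map_integral_le Real.continuous_exp.continuousOn isClosed_univ
      (ae_of_all _ fun _ => Set.mem_univ _) hYint hYexp
  have hunion : ∫ x, Real.exp (G x - b (c.enc x)) ∂c.inputLaw ≤ κ ^ n := by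
    rw [← ENNReal.ofReal_le_ofReal_iff (by positivity), ofReal_integral_eq_lintegral_ofReal hYexp
      (ae_of_all _ fun _ => (Real.exp_pos _).le)]
    have hmk : ∀ k, Measurable fun x : (Fin n → 𝓒.Dataset) × c.Ω =>
        ENNReal.ofReal (Real.exp (S fun i => (x.1 i, c.cand k x.2 i))) := fun k =>
      ((hS.comp (c.measurable_pairs k)).exp).ennreal_ofReal
    calc ∫⁻ x, ENNReal.ofReal (Real.exp (G x - b (c.enc x))) ∂c.inputLaw
        ≤ ∫⁻ x, ∑' k, a k * ENNReal.ofReal (Real.exp (S fun i => (x.1 i, c.cand k x.2 i)))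
            ∂c.inputLaw := by
          refine lintegral_mono fun x => ?_
          refine le_trans ?_ (ENNReal.le_tsum (c.enc x))
          rw [sub_eq_add_neg, Real.exp_add, ENNReal.ofReal_mul (Real.exp_pos _).le, mul_comm]
          exact mul_le_mul_left (hab x) _
      _ = ∑' k, a k * ENNReal.ofReal (κ ^ n) := by
          rw [lintegral_tsum fun k => ((hmk k).const_mul _).aemeasurable]
          congr 1
          ext k
          rw [lintegral_const_mul _ (hmk k), ← hSexp, ← c.map_pairs k,
            lintegral_map hS.exp.ennreal_ofReal (c.measurable_pairs k)]
      _ ≤ ENNReal.ofReal (κ ^ n) := by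
          rw [ENNReal.tsum_mul_right]
          exact mul_le_of_le_one_left zero_le ha
  have hmain : ∫ x, (G x - b (c.enc x)) ∂c.inputLaw ≤ n * Real.log κ := by
    rw [← Real.log_pow]
    exact (Real.le_log_iff_exp_le (by positivity)).2 (hjensen.trans hunion)
  rw [integral_sub (integrable_of_bounded hG hGb) hint] at hmain
  have hGsum : ∫ x, G x ∂c.inputLaw = ∑ i, ∫ y, g y ∂(c.outJoint i) := by
    rw [integral_finsetSum _ fun i _ => integrable_of_bounded (hgi i) fun x => hK _]
    refine Finset.sum_congr rfl fun i _ => ?_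
    rw [outJoint, integral_map (c.measurable_out i).aemeasurable hg.aestronglyMeasurable]
  have hn' : (0 : ℝ) < n := by positivity
  rw [c.integral_avgJoint hg hK, ← hGsum, ← mul_le_mul_iff_right₀ hn']
  field_simp
  linarith

end Code
end Problem

/-! ### Rates and distortions of codes -/

namespace Problem
namespace Code

variable {C Z H : Type*} [MeasurableSpace C] [MeasurableSpace Z] [MeasurableSpace H]
  {𝓒 : Problem C Z H} {P : Measure H} {n : ℕ}

theorem gibbsBound_of_hasFixedRate [IsProbabilityMeasure P] (c : Code 𝓒 P n) (hn : n ≠ 0)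
    {R : ℝ≥0} (h : c.HasFixedRate R) :
    GibbsBound (R * Real.log 2) c.avgJoint (𝓒.dataLaw.prod P) := by
  obtain ⟨M, hM, henc⟩ := h
  obtain ⟨x₀⟩ : Nonempty ((Fin n → 𝓒.Dataset) × c.Ω) := c.inputLaw.nonempty_of_neZero
  have hM0 : 0 < M := (Nat.zero_le _).trans_lt (henc x₀)
  have hM0' : (0 : ℝ) < M := by exact_mod_cast hM0
  have hn' : (0 : ℝ) < n := by positivity
  refine (c.gibbsBound_avgJoint hn (a := fun k => if k < M then ENNReal.ofReal (M : ℝ)⁻¹ else 0)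
    (b := fun _ => Real.log M) ?_ (fun _ => Real.log_natCast_nonneg M) ?_
    (integrable_const _)).mono ?_
  · rw [tsum_eq_sum (s := Finset.range M) fun k hk => if_neg (by simpa using hk)]
    rw [Finset.sum_congr rfl fun k hk => if_pos (Finset.mem_range.1 hk)]
    rw [Finset.sum_const, Finset.card_range, nsmul_eq_mul, ENNReal.ofReal_inv_of_pos hM0',
      ENNReal.ofReal_natCast]
    exact (ENNReal.mul_inv_cancel (by exact_mod_cast hM0.ne') (ENNReal.natCast_ne_top M)).le
  · intro x
    rw [if_pos (henc x), Real.exp_neg, Real.exp_log hM0']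
  · rw [integral_const, probReal_univ, one_smul, div_le_iff₀ hn']
    calc Real.log M ≤ Real.log (2 ^ ((n : ℝ) * R)) := Real.log_le_log hM0' hM
      _ = R * Real.log 2 * n := by rw [Real.log_rpow (by norm_num)]; ring

theorem gibbsBound_of_hasAverageRate [IsProbabilityMeasure P] (c : Code 𝓒 P n) (hn : n ≠ 0)
    {R : ℝ≥0} (h : c.HasAverageRate R) :
    GibbsBound (R * Real.log 2) c.avgJoint (𝓒.dataLaw.prod P) := by
  obtain ⟨word, hpre, hlen⟩ := h
  have hn' : (0 : ℝ) < n := by positivity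
  have hlog : 0 < Real.log 2 := Real.log_pos (by norm_num)
  have hm : Measurable fun x => ((word (c.enc x)).length : ℝ) :=
    (measurable_from_top (f := fun k => ((word k).length : ℝ))).comp c.measurable_enc
  have e : ∀ x, ENNReal.ofReal ((word (c.enc x)).length : ℝ) = ((word (c.enc x)).length : ℝ≥0∞) :=
    fun x => ENNReal.ofReal_natCast _
  have hfin : (n : ℝ≥0∞) * (R : ℝ≥0∞) ≠ ∞ :=
    ENNReal.mul_ne_top (ENNReal.natCast_ne_top n) ENNReal.coe_ne_top
  have hint : Integrable (fun x => ((word (c.enc x)).length : ℝ)) c.inputLaw := by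
    refine (lintegral_ofReal_ne_top_iff_integrable hm.aestronglyMeasurable
      (ae_of_all _ fun _ => Nat.cast_nonneg _)).1 ?_
    simp_rw [e]
    exact ne_top_of_le_ne_top hfin hlen
  have hval : ∫ x, ((word (c.enc x)).length : ℝ) ∂c.inputLaw ≤ n * R := by
    rw [integral_eq_lintegral_of_nonneg_ae (ae_of_all _ fun _ => Nat.cast_nonneg _)
      hm.aestronglyMeasurable]
    simp_rw [e]
    refine (ENNReal.toReal_mono hfin hlen).trans_eq ?_
    simp
  refine (c.gibbsBound_avgJoint hn (a := fun k => (2⁻¹ : ℝ≥0∞) ^ (word k).length)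
    (b := fun k => (word k).length * Real.log 2) (tsum_two_inv_pow_length_le_one hpre)
    (fun k => by positivity) ?_ (hint.mul_const _)).mono ?_
  · intro x
    rw [← mul_neg, Real.exp_nat_mul, Real.exp_neg, Real.exp_log (by norm_num),
      ENNReal.ofReal_pow (by norm_num), ENNReal.ofReal_inv_of_pos (by norm_num)]
    simp
  · rw [integral_mul_const, div_le_iff₀ hn']
    nlinarith

theorem gibbsBound_of_hasRate [IsProbabilityMeasure P] (c : Code 𝓒 P n) (hn : n ≠ 0)
    {R : ℝ≥0} {r : RateKind} (h : c.HasRate R r) :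
    GibbsBound (R * Real.log 2) c.avgJoint (𝓒.dataLaw.prod P) := by
  cases r
  · exact c.gibbsBound_of_hasFixedRate hn h
  · exact c.gibbsBound_of_hasAverageRate hn h

section Distortion

variable [StandardBorelSpace H] [Nonempty H] {ρ : 𝓒.Dataset × H → ℝ}

instance (c : Code 𝓒 P n) (i : Fin n) : IsMarkovKernel (c.outBelief i) :=
  inferInstanceAs (IsMarkovKernel (c.outJoint i).condKernel)

theorem dSem_outBelief [IsProbabilityMeasure P] (hρ : 𝓒.IsPosteriorLoss P ρ) (c : Code 𝓒 P n)
    (i : Fin n) :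
    𝓒.dSem 𝓒.belief (c.outBelief i) = ∫ y, ρ y ∂(c.outJoint i) - 𝓒.baseLoss := by
  have h := hρ.dSem_eq (c.outBelief i) inferInstance
  rw [c.dataLaw_compProd_outBelief] at h
  exact h (c.outJoint_absolutelyContinuous i)

theorem integral_avgJoint_le_distortion [IsProbabilityMeasure P] (hρ : 𝓒.IsPosteriorLoss P ρ)
    (c : Code 𝓒 P n) (hn : n ≠ 0) (d : DistortionKind) :
    ∫ y, ρ y ∂c.avgJoint - 𝓒.baseLoss ≤ c.distortion d := by
  have hn' : (0 : ℝ) < n := by positivity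
  have havg : ∫ y, ρ y ∂c.avgJoint - 𝓒.baseLoss = c.dAvg := by
    rw [c.integral_avgJoint hρ.measurable hρ.abs_le_one, dAvg]
    simp_rw [c.dSem_outBelief hρ, Finset.sum_sub_distrib]
    simp only [Finset.sum_const, Finset.card_univ, Fintype.card_fin, nsmul_eq_mul]
    field_simp
  rw [havg]
  cases d with
  | avg => exact le_rfl
  | max =>
    change c.dAvg ≤ c.dMax
    rw [dAvg, one_div, inv_mul_le_iff₀ hn', dMax]
    calc ∑ i, 𝓒.dSem 𝓒.belief (c.outBelief i)
        ≤ ∑ _i : Fin n, ⨆ j, 𝓒.dSem 𝓒.belief (c.outBelief j) :=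
          Finset.sum_le_sum fun i _ => le_ciSup (f := fun j => 𝓒.dSem 𝓒.belief (c.outBelief j))
            (Set.finite_range _).bddAbove i
      _ = n * ⨆ j, 𝓒.dSem 𝓒.belief (c.outBelief j) := by simp

/-- A code whose output laws have the same expected posterior loss at all positions has a distortion
that does not depend on the way the positions are combined. -/
theorem distortion_eq_of_const [IsProbabilityMeasure P] (hρ : 𝓒.IsPosteriorLoss P ρ)
    (c : Code 𝓒 P n) (hn : n ≠ 0) {D : ℝ} (h : ∀ i, ∫ y, ρ y ∂(c.outJoint i) = D)
    (d : DistortionKind) : c.distortion d = D - 𝓒.baseLoss := by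
  have hn' : (0 : ℝ) < n := by positivity
  have : Nonempty (Fin n) := ⟨⟨0, Nat.pos_of_ne_zero hn⟩⟩
  have e : ∀ i, 𝓒.dSem 𝓒.belief (c.outBelief i) = D - 𝓒.baseLoss := fun i => by
    rw [c.dSem_outBelief hρ, h]
  cases d with
  | avg =>
    change c.dAvg = _
    simp only [dAvg, e, Finset.sum_const, Finset.card_univ, Fintype.card_fin, nsmul_eq_mul]
    field_simp
  | max =>
    change c.dMax = _
    simp only [dMax, e, ciSup_const]

end Distortion

end Code

end Problem

/-! ### The converse -/

namespace Problem

variable {C Z H : Type*} [MeasurableSpace C] [MeasurableSpace Z] [MeasurableSpace H]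

theorem klCost_eq [MeasurableSpace.CountablyGenerated H] (𝓒 : Problem C Z H) (P : Measure H)
    [IsProbabilityMeasure P] (Q : Kernel 𝓒.Dataset H) [IsMarkovKernel Q] :
    𝓒.klCost P Q
      = klDiv (𝓒.dataLaw ⊗ₘ Q) (𝓒.dataLaw.prod P) / ENNReal.ofReal (Real.log 2) := by
  have hm := measurable_klDiv_kernel Q P
  have hm' : Measurable fun x : C × 𝓒.Dataset => klDiv (Q x.2) P := hm.comp measurable_snd
  unfold klCost klBits
  simp_rw [div_eq_mul_inv]
  rw [lintegral_mul_const _ hm', ← lintegral_klDiv_eq]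
  congr 1
  exact (lintegral_map hm measurable_snd).symm

variable [StandardBorelSpace H] [Nonempty H]

/-- The converse. The average output laws of codes that witness a point of the region have a
setwise limit; it keeps the Gibbs bound and the expected posterior loss, and disintegrates into a
feasible kernel. -/
theorem exists_feasible_of_mem_region (𝓒 : Problem C Z H) (P : Measure H)
    [IsProbabilityMeasure P] {r : RateKind} {d : DistortionKind} {R : ℝ≥0} {ε : ℝ}
    (h : (R, ε) ∈ 𝓒.region P r d) : ∃ Q ∈ 𝓒.feasible ε, 𝓒.klCost P Q ≤ R := by
  obtain ⟨ρ, hρ⟩ := 𝓒.exists_isPosteriorLoss P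
  set ν := 𝓒.dataLaw.prod P
  have hcode : ∀ x : ℝ≥0 × ℝ, 𝓒.Achievable P r d x.1 x.2 → ∃ μ : Measure (𝓒.Dataset × H),
      IsProbabilityMeasure μ ∧ μ.fst = 𝓒.dataLaw ∧ GibbsBound (x.1 * Real.log 2) μ ν ∧
      ∫ y, ρ y ∂μ - 𝓒.baseLoss ≤ x.2 := by
    rintro ⟨R', ε'⟩ ⟨code, hrate, L, hL, hlim⟩
    obtain ⟨n, hn1, hn2, hn3⟩ :=
      (hrate.and ((hlim.eventually_lt_const hL).and (eventually_ne_atTop 0))).exists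
    exact ⟨(code n).avgJoint, (code n).isProbabilityMeasure_avgJoint hn3,
      (code n).fst_avgJoint hn3, (code n).gibbsBound_of_hasRate hn3 hn1,
      ((code n).integral_avgJoint_le_distortion hρ hn3 d).trans hn2.le⟩
  obtain ⟨x, hx, hxlim⟩ := mem_closure_iff_seq_limit.1 h
  choose μs hprob hfst hgibbs hdist using fun k => hcode (x k) (hx k)
  have hR : Tendsto (fun k => ((x k).1 : ℝ) * Real.log 2) atTop (𝓝 ((R : ℝ) * Real.log 2)) :=
    ((NNReal.continuous_coe.tendsto _).comp ((continuous_fst.tendsto _).comp hxlim)).mul_const _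
  have hε : Tendsto (fun k => (x k).2) atTop (𝓝 ε) := (continuous_snd.tendsto _).comp hxlim
  let U : Ultrafilter ℕ := Filter.hyperfilter ℕ
  have hU : (U : Filter ℕ) ≤ atTop := Nat.hyperfilter_le_atTop
  obtain ⟨μ, hμ, hlim⟩ := exists_tendsto_measure_of_unif_absolutelyContinuous U μs ν
    fun e he => by
      obtain ⟨δ, hδ, hA⟩ := GibbsBound.exists_measure_le (ν := ν) (R * Real.log 2 + 1) he
      refine ⟨δ, hδ, fun A hAm hνA => hU ?_⟩
      filter_upwards [hR.eventually_lt_const (lt_add_one _)] with k hk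
      exact hA A hAm hνA (μs k) (hprob k) ((hgibbs k).mono hk.le)
  have hint := fun {g : 𝓒.Dataset × H → ℝ} (hg : Measurable g) {K : ℝ} (hK : ∀ y, |g y| ≤ K) =>
    tendsto_integral_of_tendsto_measure hlim hg hK
  have hμfst : μ.fst = 𝓒.dataLaw := by
    ext A hA
    rw [Measure.fst_apply hA]
    refine tendsto_nhds_unique (hlim _ (measurable_fst hA)) ?_
    refine tendsto_const_nhds.congr fun k => ?_
    rw [← hfst k, Measure.fst_apply hA]
  have hμgibbs : GibbsBound (R * Real.log 2) μ ν := by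
    rintro g hg ⟨K, hK⟩
    exact le_of_tendsto_of_tendsto (hint hg hK) ((hR.mono_left hU).add_const _)
      (Eventually.of_forall fun k => hgibbs k g hg ⟨K, hK⟩)
  have hμdist : ∫ y, ρ y ∂μ - 𝓒.baseLoss ≤ ε :=
    le_of_tendsto_of_tendsto ((hint hρ.measurable hρ.abs_le_one).sub_const _)
      (hε.mono_left hU) (Eventually.of_forall hdist)
  have hdis : 𝓒.dataLaw ⊗ₘ μ.condKernel = μ := by
    rw [← hμfst]; exact μ.disintegrate μ.condKernel
  refine ⟨μ.condKernel, ⟨inferInstance, ?_⟩, ?_⟩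
  · rw [hρ.dSem_eq μ.condKernel inferInstance (by rw [hdis]; exact hμgibbs.absolutelyContinuous),
      hdis]
    exact hμdist
  · have hlog : 0 < Real.log 2 := Real.log_pos (by norm_num)
    rw [𝓒.klCost_eq P, hdis]
    refine ENNReal.div_le_of_le_mul (hμgibbs.klDiv_le.trans_eq ?_)
    rw [ENNReal.ofReal_mul R.coe_nonneg, ENNReal.ofReal_coe_nnreal]

end Problem

/-! ### Typicality and random codebooks -/

theorem infinitePi_map_fin {E : Type*} [MeasurableSpace E] (μ : Measure E)
    [IsProbabilityMeasure μ] (n : ℕ) :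
    (Measure.infinitePi fun _ : ℕ => μ).map (fun ω (i : Fin n) => ω i)
      = Measure.pi fun _ : Fin n => μ := by
  have h := iIndepFun_infinitePi (P := fun _ : ℕ => μ) (X := fun _ x => x) fun _ => measurable_id
  have h' := h.precomp (g := fun i : Fin n => (i : ℕ)) Fin.val_injective
  rw [iIndepFun_iff_map_fun_eq_pi_map fun i => (measurable_pi_apply _).aemeasurable] at h'
  simp only [Measure.infinitePi_map_eval (fun _ : ℕ => μ)] at h'
  exact h'

/-- The weak law of large numbers for the coordinates of a product measure. -/
theorem tendsto_pi_measure_sum_sub_gt {E : Type*} [MeasurableSpace E] (μ : Measure E)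
    [IsProbabilityMeasure μ] {f : E → ℝ} (hf : Measurable f) (hint : Integrable f μ) {δ : ℝ}
    (hδ : 0 < δ) :
    Tendsto (fun n : ℕ => (Measure.pi fun _ : Fin n => μ)
      {y | δ * n < |∑ i, f (y i) - n * ∫ x, f x ∂μ|}) atTop (𝓝 0) := by
  set M := Measure.infinitePi fun _ : ℕ => μ
  set m := ∫ x, f x ∂μ
  have hev : ∀ i : ℕ, M.map (fun ω => ω i) = μ := fun i =>
    Measure.infinitePi_map_eval (fun _ : ℕ => μ) i
  have hXm : ∀ i : ℕ, Measurable fun ω : ℕ → E => f (ω i) := fun i => hf.comp (measurable_pi_apply i)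
  have hind : iIndepFun (fun (i : ℕ) (ω : ℕ → E) => f (ω i)) M :=
    iIndepFun_infinitePi (P := fun _ : ℕ => μ) (X := fun _ => f) fun _ => hf
  have hmap : ∀ i : ℕ, M.map (fun ω => f (ω i)) = μ.map f := fun i => by
    rw [← hev i, Measure.map_map hf (measurable_pi_apply i)]
    rfl
  have hint0 : Integrable (fun ω : ℕ → E => f (ω 0)) M := by
    have : Integrable f (M.map fun ω => ω 0) := by rwa [hev 0]
    exact this.comp_measurable (measurable_pi_apply 0)
  have hm0 : ∫ ω, f (ω 0) ∂M = m := by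
    rw [← integral_map (μ := M) (φ := fun ω => ω 0) (measurable_pi_apply 0).aemeasurable
      hf.aestronglyMeasurable, hev 0]
  have hslln := strong_law_ae_real (μ := M) (fun i ω => f (ω i)) hint0
    (fun i j hij => hind.indepFun hij)
    fun i => ⟨(hXm i).aemeasurable, (hXm 0).aemeasurable, by rw [hmap, hmap]⟩
  rw [hm0] at hslln
  have hmeas : ∀ n : ℕ, Measurable fun ω : ℕ → E => (∑ i ∈ Finset.range n, f (ω i)) / n :=
    fun n => (Finset.measurable_sum _ fun i _ => hXm i).div_const _
  have hprob := tendstoInMeasure_of_tendsto_ae (fun n => (hmeas n).aestronglyMeasurable) hslln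
  rw [tendstoInMeasure_iff_dist] at hprob
  refine tendsto_of_tendsto_of_tendsto_of_le_of_le' tendsto_const_nhds (hprob δ hδ)
    (Eventually.of_forall fun _ => zero_le) ?_
  filter_upwards [eventually_gt_atTop 0] with n hn
  have hn' : (0 : ℝ) < n := by exact_mod_cast hn
  have hset : MeasurableSet {y : Fin n → E | δ * n < |∑ i, f (y i) - n * m|} := by
    refine measurableSet_lt measurable_const (Measurable.abs (Measurable.sub_const ?_ _))
    exact Finset.measurable_sum _ fun i _ => hf.comp (measurable_pi_apply i)
  rw [← infinitePi_map_fin μ n, Measure.map_apply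
    (measurable_pi_lambda _ fun i => measurable_pi_apply _) hset]
  refine measure_mono fun ω hω => ?_
  simp only [Set.mem_preimage, Set.mem_ofPred_eq] at hω ⊢
  rw [Fin.sum_univ_eq_sum_range (fun i => f (ω i)) n] at hω
  rw [Real.dist_eq]
  have e : (∑ i ∈ Finset.range n, f (ω i)) / n - m
      = (∑ i ∈ Finset.range n, f (ω i) - n * m) / n := by field_simp
  rw [e, abs_div, abs_of_pos hn', le_div_iff₀ hn']
  exact hω.le

theorem lintegral_pi_prod {ι : Type*} [Fintype ι] {E : ι → Type*} [∀ i, MeasurableSpace (E i)]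
    (μ : ∀ i, Measure (E i)) [∀ i, IsProbabilityMeasure (μ i)] {f : ∀ i, E i → ℝ≥0∞}
    (hf : ∀ i, Measurable (f i)) :
    ∫⁻ y, ∏ i, f i (y i) ∂(Measure.pi μ) = ∏ i, ∫⁻ x, f i x ∂(μ i) := by
  have h := iIndepFun_pi (μ := μ) (X := f) fun i => (hf i).aemeasurable
  rw [lintegral_prod_eq_prod_lintegral_of_indepFun Finset.univ _ h
    fun i => (hf i).comp (measurable_pi_apply i)]
  refine Finset.prod_congr rfl fun i _ => ?_
  rw [← lintegral_map (hf i) (measurable_pi_apply i), (measurePreserving_eval μ i).map_eq]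

theorem pi_withDensity {ι E : Type*} [Fintype ι] [MeasurableSpace E] (ν : Measure E)
    [IsProbabilityMeasure ν] {w : E → ℝ≥0∞} (hw : Measurable w)
    [IsProbabilityMeasure (ν.withDensity w)] :
    Measure.pi (fun _ : ι => ν.withDensity w)
      = (Measure.pi fun _ : ι => ν).withDensity fun y => ∏ i, w (y i) := by
  refine Measure.pi_eq fun t ht => ?_
  rw [withDensity_apply _ (MeasurableSet.univ_pi ht), ← lintegral_indicator (MeasurableSet.univ_pi ht)]
  have e : ∀ y : ι → E, (Set.univ.pi t).indicator (fun y => ∏ i, w (y i)) y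
      = ∏ i, (t i).indicator w (y i) := fun y => by
    by_cases hy : y ∈ Set.univ.pi t
    · rw [Set.indicator_of_mem hy]
      exact Finset.prod_congr rfl fun i _ => (Set.indicator_of_mem (hy i trivial) _).symm
    · rw [Set.indicator_of_notMem hy]
      simp only [Set.mem_univ_pi, not_forall] at hy
      obtain ⟨i, hi⟩ := hy
      exact (Finset.prod_eq_zero (Finset.mem_univ i) (Set.indicator_of_notMem hi _)).symm
  simp_rw [e]
  rw [lintegral_pi_prod _ fun i => hw.indicator (ht i)]
  refine Finset.prod_congr rfl fun i _ => ?_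
  rw [lintegral_indicator (ht i), withDensity_apply _ (ht i)]

/-- A measurable choice of an index below `M` at which a sequence is minimal. -/
theorem exists_measurable_argmin {M : ℕ} (hM : M ≠ 0) :
    ∃ F : (ℕ → ℝ) → ℕ, Measurable F ∧ ∀ u, F u < M ∧ ∀ j < M, u (F u) ≤ u j := by
  classical
  have hex : ∀ u : ℕ → ℝ, ∃ k, k < M ∧ ∀ j < M, u k ≤ u j := fun u => by
    obtain ⟨k, hk, hmin⟩ := Finset.exists_min_image (Finset.range M) u
      ⟨0, Finset.mem_range.2 (Nat.pos_of_ne_zero hM)⟩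
    exact ⟨k, Finset.mem_range.1 hk, fun j hj => hmin j (Finset.mem_range.2 hj)⟩
  refine ⟨fun u => Nat.find (hex u), measurable_find hex fun k => ?_, fun u => Nat.find_spec (hex u)⟩
  have e : {u : ℕ → ℝ | k < M ∧ ∀ j < M, u k ≤ u j}
      = {_u : ℕ → ℝ | k < M} ∩ ⋂ j, ⋂ _ : j < M, {u | u k ≤ u j} := by
    ext u; simp
  rw [e]
  exact (MeasurableSet.const _).inter (MeasurableSet.iInter fun j => MeasurableSet.iInter fun _ =>
    measurableSet_le (measurable_pi_apply k) (measurable_pi_apply j))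

/-- The chance that none of `M` independent draws hits a set of probability at least `q / T`. -/
theorem one_sub_pow_le {p q T : ℝ} (hp : p ≤ 1) (hq0 : 0 ≤ q) (hq1 : q ≤ 1) (hT : 0 < T)
    (hqp : q ≤ T * p) (M : ℕ) : (1 - p) ^ M ≤ (1 - q) + Real.exp (-(M / T)) := by
  have hpT : q / T ≤ p := by rw [div_le_iff₀ hT]; linarith
  have h1 : (1 - p) ^ M ≤ Real.exp (q * (-(M / T))) := by
    calc (1 - p) ^ M ≤ Real.exp (-p) ^ M :=
          pow_le_pow_left₀ (by linarith) (Real.one_sub_le_exp_neg p) M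
      _ = Real.exp (M * (-p)) := (Real.exp_nat_mul _ _).symm
      _ ≤ Real.exp (q * (-(M / T))) := by
          refine Real.exp_le_exp.2 ?_
          have : (M : ℝ) * (q / T) ≤ M * p := by gcongr
          have e : q * (-((M : ℝ) / T)) = -(M * (q / T)) := by ring
          rw [e]; linarith
  -- convexity of the exponential on the segment from `0` to `-(M / T)`
  have h2 := convexOn_exp.2 (Set.mem_univ (0 : ℝ)) (Set.mem_univ (-((M : ℝ) / T)))
    (by linarith : 0 ≤ 1 - q) hq0 (by ring)
  simp only [smul_eq_mul, mul_zero, zero_add, Real.exp_zero, mul_one] at h2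
  have h3 : q * Real.exp (-((M : ℝ) / T)) ≤ Real.exp (-(M / T)) :=
    mul_le_of_le_one_left (Real.exp_pos _).le hq1
  linarith

/-- A random codebook of `M` independent candidates `x ∼ P^n` contains one that forms a pair in `B`
with the source word `s ∼ σ^n`, up to the stated probability. The density `w` of the target joint
law with respect to `σ.prod P` measures the number of candidates that are needed: it is at most `T`
on `B`. -/
theorem measure_forall_notMem_le {D H : Type*} [MeasurableSpace D] [MeasurableSpace H] {n : ℕ}
    (σ : Measure D) [IsProbabilityMeasure σ] (P : Measure H) [IsProbabilityMeasure P]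
    {w : D × H → ℝ≥0∞} (hw : Measurable w) (hw1 : ∀ s, ∫⁻ h, w (s, h) ∂P ≤ 1)
    [IsProbabilityMeasure ((σ.prod P).withDensity w)] {B : Set (Fin n → D × H)}
    (hB : MeasurableSet B) {T : ℝ} (hT : 0 < T)
    (hBT : ∀ y ∈ B, ∏ i, w (y i) ≤ ENNReal.ofReal T) (M : ℕ) :
    ((Measure.pi fun _ : Fin n => σ).prod
        (Measure.infinitePi fun _ : ℕ => Measure.pi fun _ : Fin n => P))
      {x | ∀ k < M, (fun i => (x.1 i, x.2 k i)) ∉ B}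
    ≤ (1 - (Measure.pi fun _ : Fin n => (σ.prod P).withDensity w) B)
      + ENNReal.ofReal (Real.exp (-(M / T))) := by
  set Pn := Measure.pi fun _ : Fin n => P
  set σn := Measure.pi fun _ : Fin n => σ
  let zip : (Fin n → D) × (Fin n → H) → Fin n → D × H := fun z i => (z.1 i, z.2 i)
  have hzip : Measurable zip := by fun_prop
  have hzipmap : (σn.prod Pn).map zip = Measure.pi fun _ : Fin n => σ.prod P :=
    (measurePreserving_arrowProdEquivProdArrow D H (Fin n) (fun _ => σ) (fun _ => P)).symm.map_eq
  let wn : (Fin n → D × H) → ℝ≥0∞ := fun y => ∏ i, w (y i)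
  have hwn : Measurable wn := Finset.measurable_prod _ fun i _ => hw.comp (measurable_pi_apply i)
  let Bs : (Fin n → D) → Set (Fin n → H) := fun s => {x | zip (s, x) ∈ B}
  have hBs : ∀ s, MeasurableSet (Bs s) := fun s => (hzip.comp measurable_prodMk_left) hB
  let q : (Fin n → D) → ℝ≥0∞ := fun s => ∫⁻ x, B.indicator wn (zip (s, x)) ∂Pn
  have hBz : Measurable fun z => B.indicator wn (zip z) := (hwn.indicator hB).comp hzip
  have hqm : Measurable q := hBz.lintegral_prod_right'
  have hq1 : ∀ s, q s ≤ 1 := fun s => by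
    calc q s ≤ ∫⁻ x, ∏ i, w (s i, x i) ∂Pn :=
          lintegral_mono fun x => Set.indicator_le_self _ _ _
      _ = ∏ i, ∫⁻ h, w (s i, h) ∂P :=
          lintegral_pi_prod (fun _ : Fin n => P) (f := fun i h => w (s i, h))
            fun i => hw.comp measurable_prodMk_left
      _ ≤ 1 := Finset.prod_le_one' fun i _ => hw1 (s i)
  have hqT : ∀ s, q s ≤ ENNReal.ofReal T * Pn (Bs s) := fun s => by
    calc q s ≤ ∫⁻ x, (Bs s).indicator (fun _ => ENNReal.ofReal T) x ∂Pn := by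
          refine lintegral_mono fun x => ?_
          by_cases hx : zip (s, x) ∈ B
          · rw [Set.indicator_of_mem hx, Set.indicator_of_mem (show x ∈ Bs s from hx)]
            exact hBT _ hx
          · rw [Set.indicator_of_notMem hx]; exact zero_le
      _ = ENNReal.ofReal T * Pn (Bs s) := lintegral_indicator_const (hBs s) _
  have hqint : ∫⁻ s, q s ∂σn = (Measure.pi fun _ : Fin n => (σ.prod P).withDensity w) B := by
    rw [pi_withDensity _ hw, withDensity_apply _ hB, ← lintegral_indicator hB, ← hzipmap,
      lintegral_map (hwn.indicator hB) hzip,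
      lintegral_prod _ hBz.aemeasurable]
  have hF : MeasurableSet {x : (Fin n → D) × (ℕ → Fin n → H) |
      ∀ k < M, (fun i => (x.1 i, x.2 k i)) ∉ B} := by
    have e : {x : (Fin n → D) × (ℕ → Fin n → H) | ∀ k < M, (fun i => (x.1 i, x.2 k i)) ∉ B}
        = ⋂ k, ⋂ _ : k < M, {x | (fun i => (x.1 i, x.2 k i)) ∈ B}ᶜ := by
      ext x; simp
    rw [e]
    refine MeasurableSet.iInter fun k => MeasurableSet.iInter fun _ => MeasurableSet.compl ?_
    have : Measurable fun (x : (Fin n → D) × (ℕ → Fin n → H)) (i : Fin n) =>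
        (x.1 i, x.2 k i) := by fun_prop
    exact this hB
  rw [Measure.prod_apply hF]
  have hpt : ∀ s, (Measure.infinitePi fun _ : ℕ => Pn)
      (Prod.mk s ⁻¹' {x : (Fin n → D) × (ℕ → Fin n → H) |
        ∀ k < M, (fun i => (x.1 i, x.2 k i)) ∉ B})
      ≤ (1 - q s) + ENNReal.ofReal (Real.exp (-(M / T))) := fun s => by
    have e : Prod.mk s ⁻¹' {x : (Fin n → D) × (ℕ → Fin n → H) |
        ∀ k < M, (fun i => (x.1 i, x.2 k i)) ∉ B}
        = Set.pi (Finset.range M : Set ℕ) fun _ => (Bs s)ᶜ := by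
      ext ω
      simp [Bs, zip, Set.mem_pi]
    rw [e, Measure.infinitePi_pi _ fun _ _ => (hBs s).compl, Finset.prod_const, Finset.card_range,
      prob_compl_eq_one_sub (hBs s)]
    have hqfin : q s ≠ ∞ := ne_top_of_le_ne_top ENNReal.one_ne_top (hq1 s)
    have hPfin : Pn (Bs s) ≠ ∞ := measure_ne_top _ _
    have hreal := one_sub_pow_le (p := (Pn (Bs s)).toReal) (q := (q s).toReal) (T := T)
      (ENNReal.toReal_le_of_le_ofReal zero_le_one (by simpa using prob_le_one))
      ENNReal.toReal_nonneg
      (ENNReal.toReal_le_of_le_ofReal zero_le_one (by simpa using hq1 s)) hT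
      (by
        have := ENNReal.toReal_mono (ENNReal.mul_ne_top ENNReal.ofReal_ne_top hPfin) (hqT s)
        rwa [ENNReal.toReal_mul, ENNReal.toReal_ofReal hT.le] at this) M
    have hp : 0 ≤ 1 - (Pn (Bs s)).toReal := by
      have : (Pn (Bs s)).toReal ≤ 1 :=
        ENNReal.toReal_le_of_le_ofReal zero_le_one (by simpa using prob_le_one)
      linarith
    have hq' : 0 ≤ 1 - (q s).toReal := by
      have : (q s).toReal ≤ 1 :=
        ENNReal.toReal_le_of_le_ofReal zero_le_one (by simpa using hq1 s)
      linarith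
    have h := ENNReal.ofReal_le_ofReal hreal
    rw [ENNReal.ofReal_add hq' (Real.exp_pos _).le, ENNReal.ofReal_pow hp,
      ENNReal.ofReal_sub _ ENNReal.toReal_nonneg, ENNReal.ofReal_sub _ ENNReal.toReal_nonneg,
      ENNReal.ofReal_toReal hqfin, ENNReal.ofReal_toReal hPfin, ENNReal.ofReal_one] at h
    exact h
  calc ∫⁻ s, (Measure.infinitePi fun _ : ℕ => Pn)
        (Prod.mk s ⁻¹' {x : (Fin n → D) × (ℕ → Fin n → H) |
          ∀ k < M, (fun i => (x.1 i, x.2 k i)) ∉ B}) ∂σn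
      ≤ ∫⁻ s, ((1 - q s) + ENNReal.ofReal (Real.exp (-(M / T)))) ∂σn := lintegral_mono hpt
    _ = _ := by
        rw [lintegral_add_right _ measurable_const, lintegral_const, measure_univ, mul_one,
          lintegral_sub hqm (ne_top_of_le_ne_top ENNReal.one_ne_top
            ((lintegral_mono hq1).trans_eq (by simp))) (ae_of_all _ hq1), hqint]
        simp

/-! ### Codes that select the nearest candidate -/

theorem map_comp_perm_pi {ι E : Type*} [Fintype ι] [MeasurableSpace E] (μ : Measure E)
    [IsProbabilityMeasure μ] (τ : Equiv.Perm ι) :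
    (Measure.pi fun _ : ι => μ).map (fun s i => s (τ i)) = Measure.pi fun _ : ι => μ := by
  symm
  refine Measure.pi_eq fun t ht => ?_
  rw [Measure.map_apply (by fun_prop : Measurable fun (s : ι → E) i => s (τ i))
    (MeasurableSet.univ_pi ht)]
  have e : (fun (s : ι → E) i => s (τ i)) ⁻¹' Set.univ.pi t = Set.univ.pi fun i => t (τ.symm i) := by
    ext s
    simp only [Set.mem_preimage, Set.mem_univ_pi]
    exact ⟨fun h i => by simpa using h (τ.symm i), fun h i => by simpa using h (τ i)⟩
  rw [e, Measure.pi_pi]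
  exact Equiv.prod_comp τ.symm fun i => μ (t i)

namespace Problem

variable {C Z H : Type*} [MeasurableSpace C] [MeasurableSpace Z] [MeasurableSpace H]

/-- The code whose common randomness is the i.i.d. sequence of candidates and nothing else. -/
noncomputable def codebookCode (𝓒 : Problem C Z H) (P : Measure H) [IsProbabilityMeasure P] (n : ℕ)
    (enc : (Fin n → 𝓒.Dataset) × (ℕ → Fin n → H) → ℕ) (henc : Measurable enc) : Code 𝓒 P n where
  Ω := ℕ → Fin n → H
  p := Measure.infinitePi fun _ => Measure.pi fun _ => P
  isProb := inferInstance
  cand k ω := ω k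
  measurable_cand k := measurable_pi_apply k
  map_cand k := Measure.infinitePi_map_eval (fun _ : ℕ => Measure.pi fun _ : Fin n => P) k
  indep_cand := iIndepFun_infinitePi (P := fun _ : ℕ => Measure.pi fun _ : Fin n => P)
    (X := fun _ x => x) fun _ => measurable_id
  enc := enc
  measurable_enc := henc

/-- The distances of the total losses of the candidates from the target value `n * D`. -/
noncomputable def lossGap (𝓒 : Problem C Z H) (ρ : 𝓒.Dataset × H → ℝ) (D : ℝ) (n : ℕ)
    (x : (Fin n → 𝓒.Dataset) × (ℕ → Fin n → H)) (k : ℕ) : ℝ :=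
  |∑ i, ρ (x.1 i, x.2 k i) - n * D|

theorem measurable_lossGap (𝓒 : Problem C Z H) {ρ : 𝓒.Dataset × H → ℝ} (hρ : Measurable ρ) (D : ℝ)
    (n : ℕ) : Measurable (𝓒.lossGap ρ D n) := by
  refine measurable_pi_lambda _ fun k => (Measurable.sub_const ?_ _).abs
  refine Finset.measurable_sum _ fun i _ => hρ.comp ?_
  fun_prop

/-- The code that selects the candidate whose total loss is nearest to `n * D`, by means of a
selector `F` of a minimal entry of a sequence. -/
noncomputable def nearestCode (𝓒 : Problem C Z H) (P : Measure H) [IsProbabilityMeasure P]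
    {ρ : 𝓒.Dataset × H → ℝ} (hρ : Measurable ρ) (D : ℝ) (n : ℕ) {F : (ℕ → ℝ) → ℕ}
    (hF : Measurable F) : Code 𝓒 P n :=
  𝓒.codebookCode P n (fun x => F (𝓒.lossGap ρ D n x)) (hF.comp (𝓒.measurable_lossGap hρ D n))

section NearestCode

variable (𝓒 : Problem C Z H) (P : Measure H) [IsProbabilityMeasure P] {ρ : 𝓒.Dataset × H → ℝ}
  {n : ℕ} {F : (ℕ → ℝ) → ℕ}

/-- The selection is invariant under a common permutation of the positions, so the expected loss
is the same at all positions. -/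
theorem integral_outJoint_nearestCode_eq (hρ : Measurable ρ) (D : ℝ) (hF : Measurable F)
    (i j : Fin n) :
    ∫ y, ρ y ∂((𝓒.nearestCode P hρ D n hF).outJoint i)
      = ∫ y, ρ y ∂((𝓒.nearestCode P hρ D n hF).outJoint j) := by
  set c := 𝓒.nearestCode P hρ D n hF
  let τ : Equiv.Perm (Fin n) := Equiv.swap i j
  let σ : (Fin n → 𝓒.Dataset) × c.Ω → (Fin n → 𝓒.Dataset) × c.Ω :=
    Prod.map (fun s i => s (τ i)) fun (ω : ℕ → Fin n → H) k i => ω k (τ i)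
  have hσ1 : Measurable fun (s : Fin n → 𝓒.Dataset) (i : Fin n) => s (τ i) := by fun_prop
  have hσ2 : Measurable fun (x : Fin n → H) (i : Fin n) => x (τ i) := by fun_prop
  have hσ3 : Measurable fun (ω : ℕ → Fin n → H) (k : ℕ) (i : Fin n) => ω k (τ i) := by fun_prop
  have hσ : Measurable σ := hσ1.prodMap hσ3
  have hmap : Measure.map σ c.inputLaw = c.inputLaw := by
    have h := Measure.map_prod_map (Measure.pi fun _ : Fin n => 𝓒.dataLaw)
      (Measure.infinitePi fun _ : ℕ => Measure.pi fun _ : Fin n => P) hσ1 hσ3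
    rw [map_comp_perm_pi,
      Measure.infinitePi_map_pi (fun _ : ℕ => Measure.pi fun _ : Fin n => P) fun _ => hσ2] at h
    simp_rw [map_comp_perm_pi] at h
    exact h.symm
  have henc : ∀ x, c.enc (σ x) = c.enc x := fun x => by
    change F (𝓒.lossGap ρ D n (σ x)) = F (𝓒.lossGap ρ D n x)
    congr 1
    ext k
    simp only [lossGap]
    congr 2
    exact Equiv.sum_comp τ fun i => ρ (x.1 i, x.2 k i)
  have hout : ∀ l, ∫ y, ρ y ∂(c.outJoint l)
      = ∫ x, ρ (x.1 l, c.dec (c.enc x) x.2 l) ∂c.inputLaw := fun l =>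
    integral_map (c.measurable_out l).aemeasurable hρ.aestronglyMeasurable
  have hf : Measurable fun x => ρ (x.1 i, c.dec (c.enc x) x.2 i) := hρ.comp (c.measurable_out i)
  have hσint := integral_map (μ := c.inputLaw) hσ.aemeasurable hf.aestronglyMeasurable
  rw [hmap] at hσint
  rw [hout i, hout j, hσint]
  refine integral_congr_ae (ae_of_all _ fun x => ?_)
  simp only [henc]
  change ρ (x.1 (τ i), x.2 (c.enc x) (τ i)) = ρ (x.1 j, x.2 (c.enc x) j)
  rw [Equiv.swap_apply_left]

/-- The expected loss of the nearest candidate deviates from `D` by at most `δ` plus the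
probability that no candidate comes within `n * δ` of the target. -/
theorem abs_integral_outJoint_nearestCode_sub_le (hρ : Measurable ρ)
    (hρ1 : ∀ y, ρ y ∈ Set.Icc (0 : ℝ) 1) {D : ℝ} (hD : D ∈ Set.Icc (0 : ℝ) 1) (hF : Measurable F)
    {M : ℕ} (hFM : ∀ u, F u < M ∧ ∀ j < M, u (F u) ≤ u j) {δ : ℝ} (hδ : 0 ≤ δ) (i : Fin n) :
    |∫ y, ρ y ∂((𝓒.nearestCode P hρ D n hF).outJoint i) - D|
      ≤ δ + ((Measure.pi fun _ : Fin n => 𝓒.dataLaw).prod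
        (Measure.infinitePi fun _ : ℕ => Measure.pi fun _ : Fin n => P)).real
        {x | ∀ k < M, δ * n < 𝓒.lossGap ρ D n x k} := by
  set c := 𝓒.nearestCode P hρ D n hF
  set W := (Measure.pi fun _ : Fin n => 𝓒.dataLaw).prod
    (Measure.infinitePi fun _ : ℕ => Measure.pi fun _ : Fin n => P)
  have hn : (0 : ℝ) < n := by exact_mod_cast i.pos
  let A : Set ((Fin n → 𝓒.Dataset) × (ℕ → Fin n → H)) :=
    {x | ∀ k < M, δ * n < 𝓒.lossGap ρ D n x k}
  have hgap : Measurable (𝓒.lossGap ρ D n) := 𝓒.measurable_lossGap hρ D n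
  have hA : MeasurableSet A := by
    have e : A = ⋂ k, ⋂ _ : k < M, {x | δ * n < 𝓒.lossGap ρ D n x k} := by ext x; simp [A]
    rw [e]
    exact MeasurableSet.iInter fun k => MeasurableSet.iInter fun _ =>
      measurableSet_lt measurable_const ((measurable_pi_apply k).comp hgap)
  have hb : ∀ y, |ρ y| ≤ 1 := fun y => by rw [abs_of_nonneg (hρ1 y).1]; exact (hρ1 y).2
  have hout : ∀ l, ∫ y, ρ y ∂(c.outJoint l)
      = ∫ x, ρ (x.1 l, c.dec (c.enc x) x.2 l) ∂c.inputLaw := fun l =>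
    integral_map (c.measurable_out l).aemeasurable hρ.aestronglyMeasurable
  let G : (Fin n → 𝓒.Dataset) × (ℕ → Fin n → H) → ℝ :=
    fun x => ∑ l, ρ (x.1 l, c.dec (c.enc x) x.2 l)
  have hG1 : ∀ l, Measurable fun x : (Fin n → 𝓒.Dataset) × c.Ω =>
      ρ (x.1 l, c.dec (c.enc x) x.2 l) := fun l => hρ.comp (c.measurable_out l)
  have hGi : ∀ l, Integrable (fun x => ρ (x.1 l, c.dec (c.enc x) x.2 l)) c.inputLaw :=
    fun l => integrable_of_bounded (hG1 l) fun x => hb _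
  have hGint : Integrable G W := integrable_finsetSum (μ := c.inputLaw) _ fun l _ => hGi l
  have hsum : n * ∫ y, ρ y ∂(c.outJoint i) = ∫ x, G x ∂W := by
    have h1 : ∫ x, G x ∂W = ∑ l, ∫ x, ρ (x.1 l, c.dec (c.enc x) x.2 l) ∂c.inputLaw :=
      integral_finsetSum (μ := c.inputLaw) _ fun l _ => hGi l
    rw [h1]
    simp_rw [← hout]
    rw [Finset.sum_congr rfl fun l _ =>
      𝓒.integral_outJoint_nearestCode_eq P hρ D hF l i]
    simp [c]
  have hpt : ∀ x, |G x - n * D| ≤ δ * n + A.indicator (fun _ => (n : ℝ)) x := fun x => by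
    by_cases hx : x ∈ A
    · rw [Set.indicator_of_mem hx]
      have h0 : 0 ≤ G x := Finset.sum_nonneg fun l _ => (hρ1 _).1
      have h1 : G x ≤ n := by
        calc G x ≤ ∑ _l : Fin n, (1 : ℝ) := Finset.sum_le_sum fun l _ => (hρ1 _).2
          _ = n := by simp
      have h2 : 0 ≤ n * D := mul_nonneg hn.le hD.1
      have h3 : n * D ≤ n := mul_le_of_le_one_right hn.le hD.2
      have h4 : 0 ≤ δ * n := by positivity
      rw [abs_le]
      constructor <;> linarith
    · rw [Set.indicator_of_notMem hx, add_zero]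
      simp only [A, Set.mem_ofPred_eq, not_forall, not_lt] at hx
      obtain ⟨k, hk, hle⟩ := hx
      exact ((hFM (𝓒.lossGap ρ D n x)).2 k hk).trans hle
  have hmain : |∫ x, G x ∂W - n * D| ≤ δ * n + n * W.real A := by
    have hi1 : Integrable (fun x => G x - n * D) W := hGint.sub (integrable_const _)
    have hi2 : Integrable (fun x => δ * n + A.indicator (fun _ => (n : ℝ)) x) W :=
      (integrable_const _).add ((integrable_const _).indicator hA)
    calc |∫ x, G x ∂W - n * D| = |∫ x, (G x - n * D) ∂W| := by
          rw [integral_sub hGint (integrable_const _)]; simp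
      _ ≤ ∫ x, |G x - n * D| ∂W := abs_integral_le_integral_abs
      _ ≤ ∫ x, (δ * n + A.indicator (fun _ => (n : ℝ)) x) ∂W := integral_mono hi1.abs hi2 hpt
      _ = δ * n + n * W.real A := by
          rw [integral_add (integrable_const _) ((integrable_const _).indicator hA),
            integral_indicator_const _ hA]
          simp [mul_comm]
  rw [← hsum, ← mul_sub, abs_mul, abs_of_pos hn] at hmain
  refine le_of_mul_le_mul_left (hmain.trans_eq ?_) hn
  change _ = n * (δ + W.real A)
  ring

end NearestCode

end Problem

/-! ### Achievability and the closed region -/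

theorem prod_le_ofReal_exp {ι E : Type*} [Fintype ι] {w : E → ℝ≥0∞} {y : ι → E}
    (htop : ∀ i, w (y i) ≠ ∞) {t : ℝ} (h : ∑ i, Real.log (w (y i)).toReal ≤ t) :
    ∏ i, w (y i) ≤ ENNReal.ofReal (Real.exp t) := by
  by_cases h0 : ∃ i, w (y i) = 0
  · obtain ⟨i, hi⟩ := h0
    rw [Finset.prod_eq_zero (Finset.mem_univ i) hi]
    exact zero_le
  · push Not at h0
    calc ∏ i, w (y i) = ∏ i, ENNReal.ofReal (Real.exp (Real.log (w (y i)).toReal)) := by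
          refine Finset.prod_congr rfl fun i _ => ?_
          rw [Real.exp_log (ENNReal.toReal_pos (h0 i) (htop i)), ENNReal.ofReal_toReal (htop i)]
      _ = ENNReal.ofReal (Real.exp (∑ i, Real.log (w (y i)).toReal)) := by
          rw [Real.exp_sum, ENNReal.ofReal_prod_of_nonneg fun i _ => (Real.exp_pos _).le]
      _ ≤ ENNReal.ofReal (Real.exp t) := ENNReal.ofReal_le_ofReal (Real.exp_le_exp.2 h)

/-- The words `y` of length `n` whose mean loss is within `δ` of its expectation and whose likelihood
ratio does not exceed `exp (n * c)`. -/
def typicalSet {E : Type*} (w : E → ℝ≥0∞) (ρ : E → ℝ) (D δ c : ℝ) (n : ℕ) : Set (Fin n → E) :=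
  {y | |∑ i, ρ (y i) - n * D| ≤ δ * n ∧ ∏ i, w (y i) ≤ ENNReal.ofReal (Real.exp (n * c))}

theorem measurableSet_typicalSet {E : Type*} [MeasurableSpace E] {w : E → ℝ≥0∞}
    (hw : Measurable w) {ρ : E → ℝ} (hρ : Measurable ρ) (D δ c : ℝ) (n : ℕ) :
    MeasurableSet (typicalSet w ρ D δ c n) := by
  have e : typicalSet w ρ D δ c n = {y | |∑ i, ρ (y i) - n * D| ≤ δ * n} ∩
    {y | ∏ i, w (y i) ≤ ENNReal.ofReal (Real.exp (n * c))} := rfl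
  rw [e]
  refine MeasurableSet.inter (measurableSet_le (Measurable.sub_const ?_ _).abs measurable_const)
    (measurableSet_le ?_ measurable_const)
  · exact Finset.measurable_sum _ fun i _ => hρ.comp (measurable_pi_apply i)
  · exact Finset.measurable_prod _ fun i _ => hw.comp (measurable_pi_apply i)

/-- Typical words have asymptotically full probability, by the law of large numbers for the loss
and for the logarithm of the likelihood ratio. -/
theorem tendsto_one_sub_typicalSet {E : Type*} [MeasurableSpace E] (ν : Measure E)
    [IsProbabilityMeasure ν] {w : E → ℝ≥0∞} (hw : Measurable w)
    [IsProbabilityMeasure (ν.withDensity w)] {ρ : E → ℝ} (hρ : Measurable ρ)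
    (hρint : Integrable ρ (ν.withDensity w))
    (hlog : Integrable (fun y => Real.log (w y).toReal) (ν.withDensity w))
    {δ c : ℝ} (hδ : 0 < δ) (hc : ∫ y, Real.log (w y).toReal ∂(ν.withDensity w) < c) :
    Tendsto (fun n => 1 - (Measure.pi fun _ : Fin n => ν.withDensity w)
      (typicalSet w ρ (∫ y, ρ y ∂(ν.withDensity w)) δ c n)) atTop (𝓝 0) := by
  set μ := ν.withDensity w with hμ
  set I := ∫ y, Real.log (w y).toReal ∂μ
  have hwfin : ∫⁻ y, w y ∂ν ≠ ∞ := by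
    have : μ Set.univ = ∫⁻ y, w y ∂ν := by
      rw [hμ, withDensity_apply _ MeasurableSet.univ, Measure.restrict_univ]
    rw [← this]; exact measure_ne_top _ _
  have htop : ∀ᵐ y ∂μ, w y ≠ ∞ :=
    (withDensity_absolutelyContinuous ν w).ae_le
      ((ae_lt_top hw hwfin).mono fun _ h => h.ne)
  have h1 := tendsto_pi_measure_sum_sub_gt μ hρ hρint hδ
  have h2 := tendsto_pi_measure_sum_sub_gt μ hw.ennreal_toReal.log hlog (sub_pos.2 hc)
  have h3 := h1.add h2
  rw [add_zero] at h3
  refine tendsto_of_tendsto_of_tendsto_of_le_of_le tendsto_const_nhds h3 (fun _ => zero_le)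
    fun n => ?_
  dsimp only
  rw [← prob_compl_eq_one_sub (measurableSet_typicalSet hw hρ _ _ _ _)]
  refine le_trans (measure_mono_ae ?_) (measure_union_le _ _)
  have hall : ∀ᵐ y ∂(Measure.pi fun _ : Fin n => μ), ∀ i, w (y i) ≠ ∞ :=
    ae_all_iff.2 fun i =>
      (Measure.quasiMeasurePreserving_eval (fun _ : Fin n => μ) i).ae htop
  filter_upwards [hall] with y hy hyB
  by_contra hcon
  obtain ⟨hcon1, hcon2⟩ := not_or.1 hcon
  refine hyB ⟨not_lt.1 fun h => hcon1 h, prod_le_ofReal_exp hy ?_⟩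
  have hI : |∑ i, Real.log (w (y i)).toReal - n * I| ≤ (c - I) * n := not_lt.1 fun h => hcon2 h
  have := le_of_abs_le hI
  linarith

namespace Problem

variable {C Z H : Type*} [MeasurableSpace C] [MeasurableSpace Z] [MeasurableSpace H]

theorem Code.HasFixedRate.mono {𝓒 : Problem C Z H} {P : Measure H} {n : ℕ} {c : Code 𝓒 P n}
    {R R' : ℝ≥0} (h : c.HasFixedRate R) (hR : R ≤ R') : c.HasFixedRate R' := by
  obtain ⟨M, hM, henc⟩ := h
  refine ⟨M, hM.trans (Real.rpow_le_rpow_of_exponent_le (by norm_num) ?_), henc⟩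
  gcongr

/-- A fixed-rate code has an average rate that is larger by at most two bits per block. -/
theorem Code.HasFixedRate.hasAverageRate {𝓒 : Problem C Z H} {P : Measure H} {n : ℕ}
    {c : Code 𝓒 P n} {R R' : ℝ≥0} (h : c.HasFixedRate R) (hR : (n : ℝ) * R + 2 ≤ n * R') :
    c.HasAverageRate R' := by
  obtain ⟨M, hM, henc⟩ := h
  set b := ⌈(n : ℝ) * R⌉₊ with hb
  have hMb : M ≤ 2 ^ b := by
    have h1 : (2 : ℝ) ^ ((n : ℝ) * R) ≤ 2 ^ (b : ℝ) :=
      Real.rpow_le_rpow_of_exponent_le (by norm_num) (Nat.le_ceil _)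
    rw [Real.rpow_natCast] at h1
    exact_mod_cast hM.trans h1
  obtain ⟨word, hpre, hlen⟩ := exists_prefixFree_length_eq b
  refine ⟨word, hpre, ?_⟩
  have hb1 : ((b + 1 : ℕ) : ℝ≥0∞) ≤ (n : ℝ≥0∞) * R' := by
    have h1 : (b : ℝ) < n * R + 1 := Nat.ceil_lt_add_one (by positivity)
    have h2 : ((b + 1 : ℕ) : ℝ≥0) ≤ (n : ℝ≥0) * R' := by
      rw [← NNReal.coe_le_coe]
      push_cast
      linarith
    exact_mod_cast h2
  calc ∫⁻ x, ((word (c.enc x)).length : ℝ≥0∞) ∂c.inputLaw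
      = ∫⁻ _, ((b + 1 : ℕ) : ℝ≥0∞) ∂c.inputLaw :=
        lintegral_congr fun x => by rw [hlen _ ((henc x).trans_le hMb)]
    _ = ((b + 1 : ℕ) : ℝ≥0∞) := by simp
    _ ≤ _ := hb1

variable [StandardBorelSpace H] [Nonempty H]

/-- Achievability. For any fixed rate above the divergence, nearest-candidate codes have
distortions that converge to the distortion of the given kernel. -/
theorem exists_code_tendsto (𝓒 : Problem C Z H) (P : Measure H) [IsProbabilityMeasure P]
    (Q : Kernel 𝓒.Dataset H) [IsMarkovKernel Q] {R : ℝ≥0}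
    (hR : klDiv (𝓒.dataLaw ⊗ₘ Q) (𝓒.dataLaw.prod P) < ENNReal.ofReal (R * Real.log 2)) :
    ∃ code : ∀ n, Code 𝓒 P n, (∀ n, (code n).HasFixedRate R) ∧
      ∀ d, Tendsto (fun n => (code n).distortion d) atTop (𝓝 (𝓒.dSem 𝓒.belief Q)) := by
  obtain ⟨ρ, hρ⟩ := 𝓒.exists_isPosteriorLoss P
  set ν := 𝓒.dataLaw.prod P with hν
  obtain ⟨hac, hllr⟩ := klDiv_ne_top_iff.1 hR.ne_top
  let w : 𝓒.Dataset × H → ℝ≥0∞ := fun p => Kernel.rnDeriv Q (Kernel.const 𝓒.Dataset P) p.1 p.2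
  have hw : Measurable w := Kernel.measurable_rnDeriv Q (Kernel.const 𝓒.Dataset P)
  have hμ : 𝓒.dataLaw ⊗ₘ Q = ν.withDensity w := compProd_eq_withDensity hac
  have hlogeq : (fun y => Real.log (w y).toReal) =ᵐ[𝓒.dataLaw ⊗ₘ Q]
      llr (𝓒.dataLaw ⊗ₘ Q) ν := by
    have h := Measure.rnDeriv_withDensity ν hw
    rw [← hμ] at h
    filter_upwards [hac.ae_le h] with y hy
    rw [llr, hy]
  have hD : 𝓒.dSem 𝓒.belief Q = ∫ y, ρ y ∂(𝓒.dataLaw ⊗ₘ Q) - 𝓒.baseLoss :=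
    hρ.dSem_eq Q inferInstance hac
  have hloss : Integrable ρ (𝓒.dataLaw ⊗ₘ Q) := integrable_of_bounded hρ.measurable hρ.abs_le_one
  have hlogint : Integrable (fun y => Real.log (w y).toReal) (𝓒.dataLaw ⊗ₘ Q) :=
    hllr.congr hlogeq.symm
  set D := ∫ y, ρ y ∂(𝓒.dataLaw ⊗ₘ Q) with hDdef
  have hD01 : D ∈ Set.Icc (0 : ℝ) 1 := by
    refine ⟨integral_nonneg fun y => (hρ.mem_Icc y).1, ?_⟩
    calc D ≤ ∫ _, (1 : ℝ) ∂(𝓒.dataLaw ⊗ₘ Q) :=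
          integral_mono hloss (integrable_const _) fun y => (hρ.mem_Icc y).2
      _ = 1 := by simp
  set I := ∫ y, Real.log (w y).toReal ∂(𝓒.dataLaw ⊗ₘ Q) with hI
  have hIkl : I = (klDiv (𝓒.dataLaw ⊗ₘ Q) ν).toReal := by
    rw [toReal_klDiv_of_measure_eq hac (by simp), hI]
    exact integral_congr_ae hlogeq
  have hI0 : 0 ≤ I := hIkl ▸ ENNReal.toReal_nonneg
  have hIR : I < R * Real.log 2 := by
    rw [hIkl]
    exact (ENNReal.lt_ofReal_iff_toReal_lt hR.ne_top).1 hR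
  -- the codebook size exceeds the likelihood ratio `exp (n * c)` of typical words exponentially
  obtain ⟨c, hIc, hcR⟩ := exists_between hIR
  let M : ℕ → ℕ := fun n => ⌊(2 : ℝ) ^ ((n : ℝ) * R)⌋₊
  have hM0 : ∀ n, M n ≠ 0 := fun n => by
    have : (1 : ℝ) ≤ 2 ^ ((n : ℝ) * R) := Real.one_le_rpow (by norm_num) (by positivity)
    exact (Nat.floor_pos.2 this).ne'
  have hratio : Tendsto (fun n : ℕ => (M n : ℝ) / Real.exp (n * c)) atTop atTop := by
    have h1 : Tendsto (fun n : ℕ => Real.exp ((R * Real.log 2 - c) * n) - 1) atTop atTop :=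
      tendsto_atTop_add_const_right _ _ (Real.tendsto_exp_atTop.comp
        (tendsto_natCast_atTop_atTop.const_mul_atTop (sub_pos.2 hcR)))
    refine tendsto_atTop_mono (fun n => ?_) h1
    rw [le_div_iff₀ (Real.exp_pos _), sub_mul, ← Real.exp_add, one_mul]
    have h2 : (2 : ℝ) ^ ((n : ℝ) * R) < M n + 1 := Nat.lt_floor_add_one _
    have h3 : (2 : ℝ) ^ ((n : ℝ) * R) = Real.exp ((R * Real.log 2 - c) * n + n * c) := by
      rw [Real.rpow_def_of_pos (by norm_num)]
      congr 1; ring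
    have h4 : 1 ≤ Real.exp (n * c) :=
      Real.one_le_exp (mul_nonneg n.cast_nonneg (hI0.trans hIc.le))
    rw [← h3]
    linarith
  choose F hFm hFM using fun n => exists_measurable_argmin (hM0 n)
  refine ⟨fun n => 𝓒.nearestCode P hρ.measurable D n (hFm n), fun n => ⟨M n,
    Nat.floor_le (by positivity), fun x => (hFM n _).1⟩, fun d => ?_⟩
  have hw1 : ∀ s, ∫⁻ h, w (s, h) ∂P ≤ 1 := fun s => lintegral_kernelRnDeriv_le_one Q P s
  have : IsProbabilityMeasure (ν.withDensity w) := hμ ▸ inferInstance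
  have hfail : ∀ δ > 0, Tendsto (fun n : ℕ => ((Measure.pi fun _ : Fin n => 𝓒.dataLaw).prod
      (Measure.infinitePi fun _ : ℕ => Measure.pi fun _ : Fin n => P)).real
      {x | ∀ k < M n, δ * n < 𝓒.lossGap ρ D n x k}) atTop (𝓝 0) := by
    intro δ hδ
    have h1 := tendsto_one_sub_typicalSet ν hw hρ.measurable (hμ ▸ hloss) (hμ ▸ hlogint) hδ
      (c := c) (hμ ▸ hIc)
    rw [← hμ, ← hDdef] at h1
    have h2 : Tendsto (fun n : ℕ => ENNReal.ofReal (Real.exp (-((M n : ℝ) / Real.exp (n * c)))))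
        atTop (𝓝 0) := by
      have := ENNReal.tendsto_ofReal (Real.tendsto_exp_neg_atTop_nhds_zero.comp hratio)
      rwa [ENNReal.ofReal_zero] at this
    have h3 := h1.add h2
    rw [add_zero] at h3
    have h4 := tendsto_of_tendsto_of_tendsto_of_le_of_le tendsto_const_nhds h3
      (fun _ => zero_le) fun n => (measure_mono (μ := (Measure.pi fun _ : Fin n => 𝓒.dataLaw).prod
        (Measure.infinitePi fun _ : ℕ => Measure.pi fun _ : Fin n => P))
        (s := {x | ∀ k < M n, δ * n < 𝓒.lossGap ρ D n x k})
        (t := {x | ∀ k < M n, (fun i => (x.1 i, x.2 k i)) ∉ typicalSet w ρ D δ c n})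
        fun x hx k hk hmem => (hx k hk).not_ge hmem.1).trans (by
          have := measure_forall_notMem_le 𝓒.dataLaw P hw hw1
            (measurableSet_typicalSet hw hρ.measurable D δ c n) (Real.exp_pos (n * c))
            (fun y hy => hy.2) (M n)
          rw [← hν, ← hμ] at this
          exact this)
    exact (ENNReal.tendsto_toReal ENNReal.zero_ne_top).comp h4
  rw [hD, Metric.tendsto_nhds]
  intro e he
  filter_upwards [(hfail (e / 2) (by positivity)).eventually_lt_const (half_pos he),
    eventually_gt_atTop 0] with n hn hn0
  let i₀ : Fin n := ⟨0, hn0⟩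
  rw [(𝓒.nearestCode P hρ.measurable D n (hFm n)).distortion_eq_of_const hρ hn0.ne'
    (fun i => 𝓒.integral_outJoint_nearestCode_eq P hρ.measurable D (hFm n) i i₀) d,
    Real.dist_eq, sub_sub_sub_cancel_right]
  have := 𝓒.abs_integral_outJoint_nearestCode_sub_le P hρ.measurable hρ.mem_Icc hD01 (hFm n)
    (hFM n) (half_pos he).le i₀
  linarith

/-- The slack between `klCost P Q` and `R` absorbs the two extra bits per block of a prefix-free
code. -/
theorem achievable_of_klCost_lt (𝓒 : Problem C Z H) (P : Measure H) [IsProbabilityMeasure P]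
    (r : RateKind) (d : DistortionKind) {Q : Kernel 𝓒.Dataset H} [IsMarkovKernel Q] {R : ℝ≥0}
    (hR : 𝓒.klCost P Q < R) {ε : ℝ} (hε : 𝓒.dSem 𝓒.belief Q < ε) :
    𝓒.Achievable P r d R ε := by
  obtain ⟨R₀, h1, h2⟩ := ENNReal.lt_iff_exists_nnreal_btwn.1 hR
  have hlt : R₀ < R := by exact_mod_cast h2
  have hlog : 0 < Real.log 2 := Real.log_pos (by norm_num)
  rw [𝓒.klCost_eq P, ENNReal.div_lt_iff (Or.inl (by simpa using hlog))
    (Or.inl ENNReal.ofReal_ne_top), ← ENNReal.ofReal_coe_nnreal,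
    ← ENNReal.ofReal_mul R₀.coe_nonneg] at h1
  obtain ⟨code, hrate, hlim⟩ := 𝓒.exists_code_tendsto P Q h1
  refine ⟨code, ?_, _, hε, hlim d⟩
  cases r with
  | fixed => exact Eventually.of_forall fun n => (hrate n).mono hlt.le
  | average =>
    have hpos : (0 : ℝ) < R - R₀ := sub_pos.2 (by exact_mod_cast hlt)
    have : ∀ᶠ n : ℕ in atTop, 2 ≤ ((R : ℝ) - R₀) * n :=
      (tendsto_natCast_atTop_atTop.const_mul_atTop hpos).eventually_ge_atTop 2
    filter_upwards [this] with n hn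
    exact (hrate n).hasAverageRate (by linarith)

theorem mem_region_of_mem_feasible (𝓒 : Problem C Z H) (P : Measure H) [IsProbabilityMeasure P]
    (r : RateKind) (d : DistortionKind) {Q : Kernel 𝓒.Dataset H} {ε : ℝ} (hQ : Q ∈ 𝓒.feasible ε)
    {R : ℝ≥0} (hR : 𝓒.klCost P Q ≤ R) : (R, ε) ∈ 𝓒.region P r d := by
  obtain ⟨hMarkov, hdist⟩ := hQ
  refine mem_closure_iff_seq_limit.2
    ⟨fun k => (R + 1 / ((k : ℝ≥0) + 1), ε + 1 / ((k : ℝ) + 1)), fun k => ?_, ?_⟩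
  · refine 𝓒.achievable_of_klCost_lt P r d (Q := Q) (hR.trans_lt ?_) (hdist.trans_lt ?_)
    · exact_mod_cast lt_add_of_pos_right R (by positivity : 0 < 1 / ((k : ℝ≥0) + 1))
    · exact lt_add_of_pos_right ε (by positivity)
  · refine Tendsto.prodMk_nhds ?_ ?_
    · have h : Tendsto (fun k : ℕ => 1 / ((k : ℝ≥0) + 1)) atTop (𝓝 0) :=
        tendsto_one_div_add_atTop_nhds_zero_nat
      simpa using h.const_add R
    · simpa using tendsto_one_div_add_atTop_nhds_zero_nat.const_add ε

/-- The infimum in the definition of the rate-distortion function is attained, as the region is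
closed. -/
theorem rateDistortion_mem_region (𝓒 : Problem C Z H) (P : Measure H) (r : RateKind)
    (d : DistortionKind) (ε : ℝ) {R : ℝ≥0} (h : 𝓒.rateDistortion P r d ε = R) :
    (R, ε) ∈ 𝓒.region P r d := by
  have hclosed : IsClosed {R : ℝ≥0 | (R, ε) ∈ 𝓒.region P r d} :=
    isClosed_closure.preimage (by fun_prop : Continuous fun R : ℝ≥0 => (R, ε))
  refine hclosed.closure_subset (Metric.mem_closure_iff.2 fun e he => ?_)
  have hlt : 𝓒.rateDistortion P r d ε < ((R + e.toNNReal : ℝ≥0) : ℝ≥0∞) := by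
    rw [h]
    exact_mod_cast lt_add_of_pos_right R (Real.toNNReal_pos.2 he)
  obtain ⟨R', hR'⟩ := iInf_lt_iff.1 hlt
  obtain ⟨hmem, hlt'⟩ := iInf_lt_iff.1 hR'
  have h1 : R' < R + e.toNNReal := by exact_mod_cast hlt'
  have h2 : R ≤ R' := by
    rw [← ENNReal.coe_le_coe, ← h]
    exact iInf₂_le R' hmem
  refine ⟨R', hmem, ?_⟩
  rw [NNReal.dist_eq, abs_sub_comm, abs_of_nonneg (sub_nonneg.2 (by exact_mod_cast h2)),
    sub_lt_iff_lt_add']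
  rw [← NNReal.coe_lt_coe, NNReal.coe_add, Real.coe_toNNReal e he.le] at h1
  exact h1

end Problem

end ConceptComm


theorem theorem2 {C : Type*} {Z : Type*} {H : Type*}
    [MeasurableSpace C] [MeasurableSpace Z] [MeasurableSpace H]
    [StandardBorelSpace H] [Nonempty H]
    (𝓒 : ConceptComm.Problem C Z H) (P : Measure H) [IsProbabilityMeasure P]
    (r : ConceptComm.Problem.RateKind) (d : ConceptComm.Problem.DistortionKind) (ε : ℝ) :
    𝓒.rateDistortion P r d ε = sInf (𝓒.klCost P '' 𝓒.feasible ε) ∧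
    ((𝓒.feasible ε).Nonempty →
      IsLeast (𝓒.klCost P '' 𝓒.feasible ε) (𝓒.rateDistortion P r d ε)) := by
  have hle : ∀ Q ∈ 𝓒.feasible ε, 𝓒.rateDistortion P r d ε ≤ 𝓒.klCost P Q := by
    intro Q hQ
    rcases eq_or_ne (𝓒.klCost P Q) ∞ with htop | htop
    · rw [htop]; exact le_top
    · lift 𝓒.klCost P Q to ℝ≥0 using htop with R hR
      exact iInf₂_le R (𝓒.mem_region_of_mem_feasible P r d hQ hR.symm.le)
  have hlow : 𝓒.rateDistortion P r d ε ∈ lowerBounds (𝓒.klCost P '' 𝓒.feasible ε) := by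
    rintro _ ⟨Q, hQ, rfl⟩
    exact hle Q hQ
  rcases eq_or_ne (𝓒.rateDistortion P r d ε) ∞ with htop | htop
  · have hall : ∀ Q ∈ 𝓒.feasible ε, 𝓒.klCost P Q = ∞ := fun Q hQ =>
      top_le_iff.1 (htop ▸ hle Q hQ)
    refine ⟨?_, fun ⟨Q, hQ⟩ => ⟨⟨Q, hQ, (hall Q hQ).trans htop.symm⟩, hlow⟩⟩
    rw [htop, eq_comm, sInf_eq_top]
    rintro _ ⟨Q, hQ, rfl⟩
    exact hall Q hQ
  · obtain ⟨R, hR⟩ : ∃ R : ℝ≥0, (R : ℝ≥0∞) = 𝓒.rateDistortion P r d ε :=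
      ⟨_, ENNReal.coe_toNNReal htop⟩
    obtain ⟨Q, hQ, hcost⟩ := 𝓒.exists_feasible_of_mem_region P
      (𝓒.rateDistortion_mem_region P r d ε hR.symm)
    have hleast : IsLeast (𝓒.klCost P '' 𝓒.feasible ε) (𝓒.rateDistortion P r d ε) :=
      ⟨⟨Q, hQ, le_antisymm (hR ▸ hcost) (hle Q hQ)⟩, hlow⟩
    exact ⟨hleast.csInf_eq.symm, fun _ => hleast⟩
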